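/- Let $K$ be an origin-symmetric convex body in $\mathbb{R}^2$ (a compact convex set with non-empty interior and $K=-K$), let $\mathrm{bd}\,K$ be its boundary and let $\|x\|_K=\inf\{\lambda>0 : x\in\lambda K\}$ be the norm with unit ball $K$. For non-zero $x,y\in\mathbb{R}^2$, say that $x$ is Birkhoff orthogonal to $y$, written $x\dashv y$, if $\|x\|_K\le\|x+ty\|_K$ for all $t\in\mathbb{R}$. Let $A(K)$ be the set of Auerbach points of $K$, that is, of those $x\in\mathrm{bd}\,K$ for which there is $y\in\mathrm{bd}\,K$ with $x\dashv y$ and $y\dashv x$, and let $E(K)$ be the union of all open non-degenerate line segments contained in $\mathrm{bd}\,K$. A B-measure on $\mathrm{bd}\,K$ is a Borel measure $\mu$ on $\mathrm{bd}\,K$ such that (i) $\mu(\mathrm{bd}\,K)=2\pi$; (ii) $\mu(X)=\mu(-X)$ for every Borel set $X\subseteq\mathrm{bd}\,K$; (iii) $\mu(\{x\})=0$ for every $x\in\mathrm{bd}\,K$; (iv) $\mu(C)=\pi/2$ for every closed arc $C\subseteq\mathrm{bd}\,K$ that contains no pair of opposite points $z,-z$ and whose end points $x$ and $y$ satisfy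 $x\dashv y$. Then there is a B-measure on $\mathrm{bd}\,K$ if and only if the set $A(K)\setminus E(K)$ is uncountable. -/

import Mathlib

open MeasureTheory

/-- The plane. -/
abbrev Plane : Type := EuclideanSpace ℝ (Fin 2)

/-- An origin-symmetric convex body in the plane: a compact convex set with non-empty interior
that is invariant under `x ↦ -x`. -/
structure IsSymmConvexBody (K : Set Plane) : Prop where
  convex : Convex ℝ K
  isCompact : IsCompact K
  interior_nonempty : (interior K).Nonempty
  neg_mem : ∀ x ∈ K, -x ∈ K

/-- Birkhoff orthogonality `x ⊣ y` in the norm with unit ball `K` (this norm is `gauge K`);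
it is used for non-zero vectors only. -/
def BirkhoffOrth (K : Set Plane) (x y : Plane) : Prop :=
  ∀ t : ℝ, gauge K x ≤ gauge K (x + t • y)

/-- The set `A(K)` of Auerbach points. -/
def auerbachPoints (K : Set Plane) : Set Plane :=
  {x | x ∈ frontier K ∧ ∃ y ∈ frontier K, BirkhoffOrth K x y ∧ BirkhoffOrth K y x}

/-- The union `E(K)` of the open non-degenerate line segments contained in the boundary of `K`. -/
def openSegmentUnion (K : Set Plane) : Set Plane :=
  {x | ∃ a b : Plane, a ≠ b ∧ openSegment ℝ a b ⊆ frontier K ∧ x ∈ openSegment ℝ a b}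

/-- The reflection `-X` of a subset `X` of the boundary of `K`. -/
def negSet (K : Set Plane) (X : Set (frontier K)) : Set (frontier K) :=
  {z | ∃ x ∈ X, (z : Plane) = -(x : Plane)}

/-- An angular measure on the boundary of `K`: a Borel measure of total mass `2π` that is
symmetric and gives mass zero to every point. -/
structure IsAngularMeasure (K : Set Plane) (μ : Measure (frontier K)) : Prop where
  total : μ Set.univ = ENNReal.ofReal (2 * Real.pi)
  symm : ∀ X : Set (frontier K), MeasurableSet X → μ (negSet K X) = μ X
  continuous : ∀ x : frontier K, μ {x} = 0

/-- `C` is a closed arc of the boundary of `K` with end points `x` and `y`. -/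
def IsClosedArc (K : Set Plane) (C : Set (frontier K)) (x y : frontier K) : Prop :=
  ∃ γ : unitInterval → frontier K,
    Continuous γ ∧ Function.Injective γ ∧ γ 0 = x ∧ γ 1 = y ∧ Set.range γ = C

/-- `C` contains no pair of opposite points. -/
def NoOppositePoints (K : Set Plane) (C : Set (frontier K)) : Prop :=
  ∀ z ∈ C, ∀ w ∈ C, (w : Plane) ≠ -(z : Plane)

/-- A B-measure: an angular measure that gives mass `π / 2` to every closed arc without opposite
points whose end points `x`, `y` satisfy `x ⊣ y`. -/
structure IsBMeasure (K : Set Plane) (μ : Measure (frontier K)) : Prop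
    extends IsAngularMeasure K μ where
  arc : ∀ (C : Set (frontier K)) (x y : frontier K), IsClosedArc K C x y →
    NoOppositePoints K C → BirkhoffOrth K x y → μ C = ENNReal.ofReal (Real.pi / 2)

/-! Lift the boundary to the line of polar angles. Birkhoff orthogonality becomes a monotone
relation `R a b` with `a < b < a + π` that commutes with the shift by `π`
(`IsSymmConvexBody.isQuarterTurn`). Auerbach points correspond to `squareFixed R`, where two quarter
turns can make exactly a half turn, and `E(K)` corresponds to `flatPoints R`, the interiors of the
fibres.

Necessity: a B-measure gives every quarter arc mass `π/2`. An angle outside `squareFixed R \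
flatPoints R` is then an end of a null arc (`IsBMeasure.exists_null_arc`): either two quarter arcs
share their far end, or two successive ones miss the half turn. Such angles form a null set because
rational ends suffice up to countably many points. The measure is therefore carried by `A(K) \
E(K)`, which must be uncountable since points have mass zero.

Sufficiency: an uncountable Borel set carries an atomless probability measure, whose periodic
distribution function is a continuous staircase `h` with `h (a + π) = h a + 1`. Monotonicity of `R`
leaves only countably many points of the carrier between two values of `R` at one angle, or between
an angle and its double quarter turn shifted back by `π`, so `h` sees neither discrepancy. For any
selection `r` of `R`, the average of `h` and `h ∘ r`, rescaled, advances by `π/2` along `R`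
(`IsQuarterTurn.exists_semiconj`), and its Stieltjes measure is the B-measure. -/

/-! ### Monotone quarter-turn relations on the line. -/

/-- A multivalued quarter turn of the line: a total, surjective, monotone relation commuting with
the translation by `π` and moving every point by an amount strictly between `0` and `π`. -/
structure IsQuarterTurn (R : ℝ → ℝ → Prop) : Prop where
  lt : ∀ {a b}, R a b → a < b
  lt_add_pi : ∀ {a b}, R a b → b < a + Real.pi
  add_pi_iff : ∀ {a b}, R (a + Real.pi) (b + Real.pi) ↔ R a b
  mono : ∀ {a b a' b'}, R a b → R a' b' → a < a' → b ≤ b'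
  total : ∀ a, ∃ b, R a b
  surj : ∀ b, ∃ a, R a b

/-- The points whose half turn is a value of the square of `R`. -/
def squareFixed (R : ℝ → ℝ → Prop) : Set ℝ := {a | ∃ b, R a b ∧ R b (a + Real.pi)}

/-- The interiors of the fibres of `R`. -/
def flatPoints (R : ℝ → ℝ → Prop) : Set ℝ := {a | ∃ a₁ a₂ b, a₁ < a ∧ a < a₂ ∧ R a₁ b ∧ R a₂ b}

lemma isOpen_flatPoints (R : ℝ → ℝ → Prop) : IsOpen (flatPoints R) := by
  rw [isOpen_iff_mem_nhds]
  rintro a ⟨a₁, a₂, b, h₁, h₂, hr⟩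
  filter_upwards [Ioo_mem_nhds h₁ h₂] with x hx using ⟨a₁, a₂, b, hx.1, hx.2, hr⟩

/-- Of three points of a fibre the middle one is flat, so at most two points survive. -/
lemma countable_fiber_diff_flatPoints (R : ℝ → ℝ → Prop) (b : ℝ) :
    ({a | R a b} \ flatPoints R).Countable := by
  set T := {a | R a b} \ flatPoints R with hT
  have key : ∀ x ∈ T, ∀ y ∈ T, ∀ z ∈ T, x < y → ¬ y < z := fun x hx y hy z hz h1 h2 =>
    hy.2 ⟨x, z, b, h1, h2, hx.1, hz.1⟩
  rcases T.eq_empty_or_nonempty with h | ⟨g, hg⟩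
  · simp [h]
  have h1 : (T ∩ Set.Iio g).Subsingleton := by
    rintro x ⟨hx, hxg⟩ y ⟨hy, hyg⟩
    rcases lt_trichotomy x y with h | h | h
    · exact absurd hyg (key x hx y hy g hg h)
    · exact h
    · exact absurd hxg (key y hy x hx g hg h)
  have h2 : (T ∩ Set.Ioi g).Subsingleton := by
    rintro x ⟨hx, hxg⟩ y ⟨hy, hyg⟩
    rcases lt_trichotomy x y with h | h | h
    · exact absurd h (key g hg x hx y hy hxg)
    · exact h
    · exact absurd h (key g hg y hy x hx hyg)
  refine ((h1.countable.union (Set.countable_singleton g)).union h2.countable).mono fun x hx => ?_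
  rcases lt_trichotomy x g with h | h | h
  · exact Or.inl (Or.inl ⟨hx, h⟩)
  · exact Or.inl (Or.inr h)
  · exact Or.inr ⟨hx, h⟩

namespace IsQuarterTurn

variable {R : ℝ → ℝ → Prop}

lemma add_pi_mem_iff (hR : IsQuarterTurn R) (a : ℝ) :
    a + Real.pi ∈ squareFixed R \ flatPoints R ↔ a ∈ squareFixed R \ flatPoints R := by
  have h1 : a + Real.pi ∈ squareFixed R ↔ a ∈ squareFixed R := by
    constructor
    · rintro ⟨b, h1, h2⟩
      refine ⟨b - Real.pi, hR.add_pi_iff.1 (by simpa using h1), hR.add_pi_iff.1 (by simpa using h2)⟩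
    · rintro ⟨b, h1, h2⟩
      exact ⟨b + Real.pi, hR.add_pi_iff.2 h1, hR.add_pi_iff.2 h2⟩
  have h2 : a + Real.pi ∈ flatPoints R ↔ a ∈ flatPoints R := by
    constructor
    · rintro ⟨x, y, b, hx, hy, h1, h2⟩
      refine ⟨x - Real.pi, y - Real.pi, b - Real.pi, by linarith, by linarith,
        hR.add_pi_iff.1 (by simpa using h1), hR.add_pi_iff.1 (by simpa using h2)⟩
    · rintro ⟨x, y, b, hx, hy, h1, h2⟩
      exact ⟨x + Real.pi, y + Real.pi, b + Real.pi, by linarith, by linarith,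
        hR.add_pi_iff.2 h1, hR.add_pi_iff.2 h2⟩
  simp only [Set.mem_sdiff, h1, h2]

lemma add_int_mul_pi_mem_iff (hR : IsQuarterTurn R) (a : ℝ) (n : ℤ) :
    a + n * Real.pi ∈ squareFixed R \ flatPoints R ↔ a ∈ squareFixed R \ flatPoints R := by
  induction n using Int.induction_on with
  | zero => simp
  | succ n ih =>
    rw [← ih, ← hR.add_pi_mem_iff (a + ((n : ℕ) : ℤ) * Real.pi)]
    push_cast
    ring_nf
  | pred n ih =>
    rw [← ih, ← hR.add_pi_mem_iff]
    push_cast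
    ring_nf

/-- If `g` lies strictly between `a` and `c - π` and goes to `g + π` through `d`, monotonicity of
the two steps pins `d = b`. All such `g` thus lie in the single fibre over `b`. -/
lemma countable_between_square (hR : IsQuarterTurn R) {a b c : ℝ} (hab : R a b) (hbc : R b c) :
    (squareFixed R \ flatPoints R ∩ Set.Ioo a (c - Real.pi)).Countable ∧
      (squareFixed R \ flatPoints R ∩ Set.Ioo (c - Real.pi) a).Countable := by
  constructor
  · refine (countable_fiber_diff_flatPoints R b).mono ?_
    rintro g ⟨⟨⟨d, h1, h2⟩, hg⟩, h3, h4⟩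
    refine ⟨?_, hg⟩
    rcases (hR.mono hab h1 h3).eq_or_lt with h | h
    · rwa [Set.mem_ofPred_eq, h]
    · linarith [hR.mono hbc h2 h]
  · refine (countable_fiber_diff_flatPoints R b).mono ?_
    rintro g ⟨⟨⟨d, h1, h2⟩, hg⟩, h3, h4⟩
    refine ⟨?_, hg⟩
    rcases (hR.mono h1 hab h4).eq_or_lt with h | h
    · rwa [Set.mem_ofPred_eq, ← h]
    · linarith [hR.mono h2 hbc h]

/-- If `g` goes to `g + π` through `d`, then `d - π` has the value `g`. A `g` strictly between `b`
and `b'` forces `d - π = a`, so it lies in the fibre over `a + π`. -/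
lemma countable_between_values (hR : IsQuarterTurn R) {a b b' : ℝ} (hb : R a b) (hb' : R a b') :
    (squareFixed R \ flatPoints R ∩ Set.Ioo b b').Countable := by
  refine (countable_fiber_diff_flatPoints R (a + Real.pi)).mono ?_
  rintro g ⟨⟨⟨d, h1, h2⟩, hg⟩, h3, h4⟩
  refine ⟨?_, hg⟩
  have h2' : R (d - Real.pi) g := hR.add_pi_iff.1 (by simpa using h2)
  rcases lt_trichotomy (d - Real.pi) a with h | h | h
  · linarith [hR.mono h2' hb h]
  · rw [Set.mem_ofPred_eq, ← h]; simpa using h1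
  · linarith [hR.mono hb' h2' h]

end IsQuarterTurn

/-! ### Staircases and the semiconjugacy to the rotation. -/

/-- An uncountable Borel set carries an atomless probability measure. -/
lemma exists_nullSingletonClass_of_not_countable {S : Set ℝ} (hS : MeasurableSet S) (hc : ¬ S.Countable) :
    ∃ ν : Measure ℝ, IsProbabilityMeasure ν ∧ NullSingletonClass ν ∧ ν Sᶜ = 0 := by
  have := hS.standardBorel
  have hS' : ¬ Countable S := hc
  -- Uncountable standard Borel spaces are isomorphic, so Lebesgue measure can be transported to
  -- `S`.
  let f : unitInterval ≃ᵐ S := PolishSpace.measurableEquivOfNotCountable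
    (fun h => Cardinal.not_countable_real (by
      have : (Set.Icc (0 : ℝ) 1).Countable := h
      have h2 := Real.volume_Icc (a := 0) (b := 1)
      rw [this.measure_zero] at h2
      norm_num at h2)) hS'
  have hf : Measurable (fun x => (f x : ℝ)) := measurable_subtype_coe.comp f.measurable
  refine ⟨(volume : Measure unitInterval).map (fun x => (f x : ℝ)),
    Measure.isProbabilityMeasure_map hf.aemeasurable, ⟨fun x => ?_⟩, ?_⟩
  · rw [Measure.map_apply hf (measurableSet_singleton x)]
    refine Set.Subsingleton.measure_zero ?_ _
    intro y hy z hz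
    exact f.injective (Subtype.ext ((Set.mem_singleton_iff.1 hy).trans
      (Set.mem_singleton_iff.1 hz).symm))
  · rw [Measure.map_apply hf hS.compl]
    convert measure_empty
    · ext x; simp
    · infer_instance

/-- A devil's staircase of degree one whose growth is carried by a `π`-periodic set. -/
lemma exists_staircase {S : Set ℝ} (hS : MeasurableSet S)
    (hper : ∀ (a : ℝ) (n : ℤ), a + n * Real.pi ∈ S ↔ a ∈ S)
    (hc : ¬ (S ∩ Set.Icc 0 (2 * Real.pi)).Countable) :
    ∃ h : ℝ → ℝ, Continuous h ∧ Monotone h ∧ (∀ a, h (a + Real.pi) = h a + 1) ∧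
      ∀ a b, a ≤ b → (S ∩ Set.Ioo a b).Countable → h a = h b := by
  obtain ⟨ν, hν, hat, hsupp⟩ :=
    exists_nullSingletonClass_of_not_countable (hS.inter measurableSet_Icc) hc
  have hpi := Real.pi_pos
  have hae : ∀ᵐ s ∂ν, s ∈ S ∩ Set.Icc 0 (2 * Real.pi) := by
    rw [ae_iff]; exact hsupp
  have hmeas : ∀ a : ℝ, Measurable (fun s : ℝ => (⌊(a - s) / Real.pi⌋ : ℝ)) := fun a =>
    (measurable_of_countable (fun n : ℤ => (n : ℝ))).comp
      (Int.measurable_floor.comp ((measurable_const.sub measurable_id).div_const _))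
  have hbd : ∀ a c : ℝ, |a| ≤ c → ∀ᵐ s ∂ν, ‖(⌊(a - s) / Real.pi⌋ : ℝ)‖ ≤ c / Real.pi + 3 := by
    intro a c hac
    filter_upwards [hae] with s hs
    obtain ⟨-, hs1, hs2⟩ := hs
    obtain ⟨h1, h2⟩ := abs_le.1 hac
    have h3 := Int.floor_le ((a - s) / Real.pi)
    have h4 := Int.lt_floor_add_one ((a - s) / Real.pi)
    have h5 : (a - s) / Real.pi ≤ c / Real.pi := by gcongr; linarith
    have h6 : -(c / Real.pi) - 2 ≤ (a - s) / Real.pi := by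
      rw [le_div_iff₀ hpi]; field_simp; linarith
    rw [Real.norm_eq_abs, abs_le]
    constructor <;> linarith
  have hint : ∀ a : ℝ, Integrable (fun s : ℝ => (⌊(a - s) / Real.pi⌋ : ℝ)) ν := fun a =>
    Integrable.of_bound (hmeas a).aestronglyMeasurable _ (hbd a |a| le_rfl)
  -- The integrand jumps by one at each point of `s + πℤ`; averaging over the atomless `ν` smooths
  -- the jumps away.
  refine ⟨fun a => ∫ s, (⌊(a - s) / Real.pi⌋ : ℝ) ∂ν, ?_, ?_, ?_, ?_⟩
  · rw [continuous_iff_continuousAt]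
    intro a
    refine continuousAt_of_dominated (bound := fun _ => (|a| + 1) / Real.pi + 3)
      (Filter.Eventually.of_forall fun b => (hmeas b).aestronglyMeasurable) ?_
      (integrable_const _) ?_
    · filter_upwards [Metric.ball_mem_nhds a one_pos] with b hb
      refine hbd b _ ?_
      rw [Metric.mem_ball, Real.dist_eq] at hb
      have := abs_sub_abs_le_abs_sub b a
      linarith
    · have hcount : (Set.range fun n : ℤ => a - n * Real.pi).Countable := Set.countable_range _
      have : ∀ᵐ s ∂ν, s ∉ Set.range fun n : ℤ => a - n * Real.pi := by
        exact measure_eq_zero_iff_ae_notMem.1 (hcount.measure_zero ν)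
      filter_upwards [this] with s hs
      have h1 : ContinuousAt (Int.floor : ℝ → ℤ) ((a - s) / Real.pi) := by
        have h2 : (⌊(a - s) / Real.pi⌋ : ℝ) < (a - s) / Real.pi := by
          refine lt_of_le_of_ne (Int.floor_le _) fun h => hs ⟨⌊(a - s) / Real.pi⌋, ?_⟩
          simp only [h]; field_simp; ring
        refine ContinuousAt.congr (f := fun _ => ⌊(a - s) / Real.pi⌋) continuousAt_const ?_
        filter_upwards [Ioo_mem_nhds h2 (Int.lt_floor_add_one _)] with x hx
        exact (Int.floor_eq_iff.2 ⟨hx.1.le, hx.2⟩).symm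
      have h3 : ContinuousAt (fun x : ℝ => (x - s) / Real.pi) a := by fun_prop
      exact (continuous_of_discreteTopology (f := fun n : ℤ => (n : ℝ))).continuousAt.comp
        (h1.comp_of_eq h3 rfl)
  · intro a b hab
    refine integral_mono (hint a) (hint b) fun s => ?_
    dsimp only
    gcongr
  · intro a
    have : ∀ s : ℝ, (⌊(a + Real.pi - s) / Real.pi⌋ : ℝ) = ⌊(a - s) / Real.pi⌋ + 1 := by
      intro s
      have : (a + Real.pi - s) / Real.pi = (a - s) / Real.pi + 1 := by field_simp; ring
      rw [this, Int.floor_add_one]; push_cast; ring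
    simp only [this]
    rw [integral_add (hint a) (integrable_const _)]
    simp
  · intro a b hab hcount
    refine integral_congr_ae ?_
    -- The two floors differ only if some `s + nπ` lies in the half-open interval from `a` to `b`,
    -- so the end point `b` joins the exceptional set.
    have hcount' : (⋃ n : ℤ, (fun x : ℝ => x - n * Real.pi) '' (insert b (S ∩ Set.Ioo a b))).Countable :=
      Set.countable_iUnion fun n => (hcount.insert b).image _
    have : ∀ᵐ s ∂ν, s ∉ ⋃ n : ℤ, (fun x : ℝ => x - n * Real.pi) '' (insert b (S ∩ Set.Ioo a b)) := by
      exact measure_eq_zero_iff_ae_notMem.1 (hcount'.measure_zero ν)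
    filter_upwards [this, hae] with s hs hsS
    by_contra hne
    apply hs
    have hle : ⌊(a - s) / Real.pi⌋ ≤ ⌊(b - s) / Real.pi⌋ := by gcongr
    have hlt : ⌊(a - s) / Real.pi⌋ < ⌊(b - s) / Real.pi⌋ :=
      lt_of_le_of_ne hle fun h => hne (by simp [h])
    set n := ⌊(b - s) / Real.pi⌋ with hn
    have h1 : (n : ℝ) ≤ (b - s) / Real.pi := Int.floor_le _
    have h2 : (a - s) / Real.pi < n := Int.floor_lt.1 hlt
    rw [le_div_iff₀ hpi] at h1
    rw [div_lt_iff₀ hpi] at h2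
    refine Set.mem_iUnion.2 ⟨n, s + n * Real.pi, ?_, by ring⟩
    rcases (show s + n * Real.pi ≤ b by linarith).eq_or_lt with h | h
    · exact Or.inl h
    · exact Or.inr ⟨(hper s n).2 hsS.1, by linarith, h⟩

/-- A multivalued quarter turn is semiconjugate to the rotation by `π / 2` as soon as the relevant
set is uncountable. -/
lemma IsQuarterTurn.exists_semiconj {R : ℝ → ℝ → Prop} (hR : IsQuarterTurn R)
    (hA : MeasurableSet (squareFixed R))
    (hc : ¬ ((squareFixed R \ flatPoints R) ∩ Set.Icc 0 (2 * Real.pi)).Countable) :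
    ∃ m : ℝ → ℝ, Continuous m ∧ Monotone m ∧ (∀ a, m (a + Real.pi) = m a + Real.pi) ∧
      ∀ a b, R a b → m b = m a + Real.pi / 2 := by
  obtain ⟨h, hcont, hmono, hper, hconst⟩ := exists_staircase
    (hA.diff (isOpen_flatPoints R).measurableSet) hR.add_int_mul_pi_mem_iff hc
  have hpi := Real.pi_pos
  have hsq : ∀ {a b c}, R a b → R b c → h c = h a + 1 := by
    intro a b c hab hbc
    have : h (c - Real.pi) = h a := by
      obtain ⟨h1, h2⟩ := hR.countable_between_square hab hbc
      rcases le_total a (c - Real.pi) with hle | hle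
      · exact (hconst _ _ hle h1).symm
      · exact hconst _ _ hle h2
    rw [← this, ← hper]; simp
  have hval : ∀ {a b b'}, R a b → R a b' → h b = h b' := by
    intro a b b' hb hb'
    rcases le_total b b' with hle | hle
    · exact hconst _ _ hle (hR.countable_between_values hb hb')
    · exact (hconst _ _ hle (hR.countable_between_values hb' hb)).symm
  -- Any selection will do, since `h` takes equal values on all values of `R` at one point.
  choose r hr using hR.total
  have hrper : ∀ a, h (r (a + Real.pi)) = h (r a) + 1 := fun a => by
    rw [← hper]; exact hval (hr _) (hR.add_pi_iff.2 (hr a))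
  have hrmono : Monotone (h ∘ r) := by
    intro a a' hle
    rcases hle.eq_or_lt with rfl | hlt
    · exact le_rfl
    · exact hmono (hR.mono (hr a) (hr a') hlt)
  have hsurj : Function.Surjective h := by
    have hnat : ∀ n : ℕ, h (n * Real.pi) = h 0 + n ∧ h (-(n * Real.pi)) = h 0 - n := by
      intro n
      induction n with
      | zero => simp
      | succ n ih =>
        constructor
        · rw [show ((n + 1 : ℕ) : ℝ) * Real.pi = n * Real.pi + Real.pi by push_cast; ring, hper, ih.1]
          push_cast; ring
        · have := hper (-((n + 1 : ℕ) * Real.pi))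
          rw [show -(((n + 1 : ℕ) : ℝ) * Real.pi) + Real.pi = -(n * Real.pi) by push_cast; ring,
            ih.2] at this
          push_cast at this ⊢; linarith
    intro y
    obtain ⟨n, hn⟩ := exists_nat_ge |y - h 0|
    obtain ⟨h1, h2⟩ := abs_le.1 hn
    exact mem_range_of_exists_le_of_exists_ge hcont ⟨_, (hnat n).2.trans_le (by linarith)⟩
      ⟨_, (show y ≤ h 0 + n by linarith).trans_eq (hnat n).1.symm⟩
  have hrsurj : Function.Surjective (h ∘ r) := by
    intro y
    obtain ⟨b, rfl⟩ := hsurj y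
    obtain ⟨a, ha⟩ := hR.surj b
    exact ⟨a, hval (hr a) ha⟩
  -- One step of `R` turns the pair `(h, h ∘ r)` into `(h ∘ r, h + 1)`, so the sum grows by one.
  -- Although `r` may jump, `h ∘ r` is monotone and onto, hence continuous.
  refine ⟨fun a => Real.pi / 2 * (h a + (h ∘ r) a),
    continuous_const.mul (hcont.add (hrmono.continuous_of_surjective hrsurj)),
    (hmono.add hrmono).const_mul (by positivity), fun a => ?_, fun a b hab => ?_⟩
  · simp only [Function.comp, hper, hrper]; ring
  · simp only [Function.comp, hval (hr a) hab, hsq hab (hr b)]; ring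

/-! ### Polar coordinates and determinants. -/

/-- The unit vector at angle `θ`. -/
noncomputable def dirVec (θ : ℝ) : Plane := !₂[Real.cos θ, Real.sin θ]

/-- The determinant of two vectors of the plane. -/
def planeDet (x y : Plane) : ℝ := x 0 * y 1 - x 1 * y 0

@[simp] lemma dirVec_zero_coord (θ : ℝ) : dirVec θ 0 = Real.cos θ := by simp [dirVec]

@[simp] lemma dirVec_one_coord (θ : ℝ) : dirVec θ 1 = Real.sin θ := by simp [dirVec]

lemma dirVec_add_pi (θ : ℝ) : dirVec (θ + Real.pi) = -dirVec θ := by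
  ext i; fin_cases i <;> simp [dirVec]

lemma dirVec_sub_pi (θ : ℝ) : dirVec (θ - Real.pi) = -dirVec θ := by
  ext i; fin_cases i <;> simp [dirVec, Real.cos_sub_pi, Real.sin_sub_pi]

lemma continuous_dirVec : Continuous dirVec := by unfold dirVec; fun_prop

lemma dirVec_ne_zero (θ : ℝ) : dirVec θ ≠ 0 := by
  intro h
  have h0 : dirVec θ 0 = 0 := by simp [h]
  have h1 : dirVec θ 1 = 0 := by simp [h]
  have := Real.sin_sq_add_cos_sq θ
  simp only [dirVec_zero_coord, dirVec_one_coord] at h0 h1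
  simp [h0, h1] at this

lemma planeDet_dirVec (θ φ : ℝ) : planeDet (dirVec θ) (dirVec φ) = Real.sin (φ - θ) := by
  simp [planeDet, Real.sin_sub]; ring

lemma planeDet_smul_left (r : ℝ) (x y : Plane) : planeDet (r • x) y = r * planeDet x y := by
  simp [planeDet]; ring

lemma planeDet_smul_right (r : ℝ) (x y : Plane) : planeDet x (r • y) = r * planeDet x y := by
  simp [planeDet]; ring

lemma planeDet_add_left (x y z : Plane) : planeDet (x + y) z = planeDet x z + planeDet y z := by
  simp [planeDet]; ring

lemma planeDet_self (x : Plane) : planeDet x x = 0 := by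
  simp [planeDet]; ring

lemma planeDet_comm (x y : Plane) : planeDet y x = -planeDet x y := by
  simp [planeDet]; ring

/-- Cramer's rule. -/
lemma planeDet_smul_eq (x y z : Plane) :
    planeDet x y • z = planeDet z y • x + planeDet x z • y := by
  ext i; fin_cases i <;> simp [planeDet] <;> ring

/-- The free start `c` of the angular window lets each use choose its branch. -/
lemma exists_polar {x : Plane} (hx : x ≠ 0) (c : ℝ) :
    ∃ r θ : ℝ, 0 < r ∧ c < θ ∧ θ ≤ c + 2 * Real.pi ∧ x = r • dirVec θ := by
  let z : ℂ := ⟨x 0, x 1⟩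
  obtain ⟨n, ⟨h1, h2⟩, -⟩ := existsUnique_add_zsmul_mem_Ioc Real.two_pi_pos z.arg c
  refine ⟨‖z‖, _, ?_, h1, h2, ?_⟩
  · rw [norm_pos_iff]
    intro h
    apply hx
    have h0 := congrArg Complex.re h
    have h1 := congrArg Complex.im h
    ext i; fin_cases i
    · exact h0
    · exact h1
  · have e1 := Complex.norm_mul_cos_arg z
    have e2 := Complex.norm_mul_sin_arg z
    ext i; fin_cases i
    · simpa [-Complex.norm_mul_cos_arg, Real.cos_add_int_mul_two_pi] using e1.symm
    · simpa [-Complex.norm_mul_sin_arg, Real.sin_add_int_mul_two_pi] using e2.symm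

lemma sin_pos_of_lt {a b : ℝ} (h1 : a < b) (h2 : b < a + Real.pi) : 0 < Real.sin (b - a) :=
  Real.sin_pos_of_pos_of_lt_pi (by linarith) (by linarith)

lemma lt_add_pi_of_sin_pos {a b : ℝ} (h2 : b ≤ a + 2 * Real.pi)
    (h : 0 < Real.sin (b - a)) : b < a + Real.pi := by
  by_contra hn
  have : 0 ≤ Real.sin (b - a - Real.pi) :=
    Real.sin_nonneg_of_nonneg_of_le_pi (by linarith) (by linarith)
  rw [Real.sin_sub_pi] at this
  linarith

/-! ### The norm and Birkhoff orthogonality. -/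

namespace IsSymmConvexBody

variable {K : Set Plane}

lemma mem_nhds_zero (hK : IsSymmConvexBody K) : K ∈ nhds 0 := by
  obtain ⟨x, hx⟩ := hK.interior_nonempty
  have hneg : -x ∈ interior K := by
    have h : (fun z : Plane => -z) ⁻¹' (interior K) ⊆ K := fun z hz => by
      simpa using hK.neg_mem _ (interior_subset hz)
    exact interior_maximal h (isOpen_interior.preimage continuous_neg) (by simpa using hx)
  have h0 := hK.convex.interior hx hneg (a := 1 / 2) (b := 1 / 2)
    (by norm_num) (by norm_num) (by norm_num)
  rw [smul_neg, add_neg_cancel] at h0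
  exact mem_interior_iff_mem_nhds.1 h0

lemma continuous_gauge (hK : IsSymmConvexBody K) : Continuous (gauge K) :=
  _root_.continuous_gauge hK.convex hK.mem_nhds_zero

lemma gauge_pos (hK : IsSymmConvexBody K) {x : Plane} (hx : x ≠ 0) : 0 < gauge K x :=
  (_root_.gauge_pos (absorbent_nhds_zero hK.mem_nhds_zero)
    (NormedSpace.isVonNBounded_of_isBounded ℝ hK.isCompact.isBounded)).2 hx

lemma gauge_smul (hK : IsSymmConvexBody K) (t : ℝ) (x : Plane) :
    gauge K (t • x) = |t| * gauge K x := by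
  rcases le_total 0 t with h | h
  · rw [gauge_smul_of_nonneg h, abs_of_nonneg h, smul_eq_mul]
  · rw [← gauge_neg hK.neg_mem, ← neg_smul, gauge_smul_of_nonneg (by linarith), abs_of_nonpos h,
      smul_eq_mul]

lemma gauge_add_le (hK : IsSymmConvexBody K) (x y : Plane) :
    gauge K (x + y) ≤ gauge K x + gauge K y :=
  _root_.gauge_add_le hK.convex (absorbent_nhds_zero hK.mem_nhds_zero) x y

lemma gauge_eq_one_iff (hK : IsSymmConvexBody K) {x : Plane} : gauge K x = 1 ↔ x ∈ frontier K :=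
  gauge_eq_one_iff_mem_frontier hK.convex hK.mem_nhds_zero

lemma ne_zero_of_mem_frontier (hK : IsSymmConvexBody K) {x : Plane} (hx : x ∈ frontier K) :
    x ≠ 0 := by
  rintro rfl
  have := hK.gauge_eq_one_iff.2 hx
  simp at this

lemma birkhoffOrth_smul (hK : IsSymmConvexBody K) {x y : Plane} (h : BirkhoffOrth K x y)
    (r s : ℝ) : BirkhoffOrth K (r • x) (s • y) := by
  intro t
  rcases eq_or_ne r 0 with rfl | hr
  · simpa using gauge_nonneg _
  have : r • x + t • s • y = r • (x + (r⁻¹ * t * s) • y) := by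
    rw [smul_add, smul_smul, smul_smul]
    congr 2
    field_simp
  rw [this, hK.gauge_smul, hK.gauge_smul]
  exact mul_le_mul_of_nonneg_left (h _) (abs_nonneg _)

lemma birkhoffOrth_smul_iff (hK : IsSymmConvexBody K) {x y : Plane} {r s : ℝ} (hr : r ≠ 0)
    (hs : s ≠ 0) : BirkhoffOrth K (r • x) (s • y) ↔ BirkhoffOrth K x y := by
  refine ⟨fun h => ?_, fun h => hK.birkhoffOrth_smul h r s⟩
  have := hK.birkhoffOrth_smul h r⁻¹ s⁻¹
  rwa [smul_smul, smul_smul, inv_mul_cancel₀ hr, inv_mul_cancel₀ hs, one_smul, one_smul] at this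

lemma planeDet_ne_zero (hK : IsSymmConvexBody K) {x y : Plane} (hx : x ≠ 0) (hy : y ≠ 0)
    (h : BirkhoffOrth K x y) : planeDet x y ≠ 0 := by
  intro hd
  obtain ⟨r, θ, hr, -, -, rfl⟩ := exists_polar hy 0
  obtain ⟨t, ht⟩ : ∃ t : ℝ, x = t • dirVec θ := by
    refine ⟨x 0 * Real.cos θ + x 1 * Real.sin θ, ?_⟩
    rw [planeDet_smul_right, mul_eq_zero, or_iff_right hr.ne'] at hd
    simp only [planeDet, dirVec_zero_coord, dirVec_one_coord] at hd
    have h1 := Real.sin_sq_add_cos_sq θ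
    ext i; fin_cases i
    · simp only [Fin.zero_eta, PiLp.smul_apply, dirVec_zero_coord, smul_eq_mul]
      linear_combination Real.sin θ * hd - x 0 * h1
    · simp only [Fin.mk_one, PiLp.smul_apply, dirVec_one_coord, smul_eq_mul]
      linear_combination -Real.cos θ * hd - x 1 * h1
  have h2 := h (-(t / r))
  rw [smul_smul, neg_mul, div_mul_cancel₀ _ hr.ne', ht, ← add_smul, add_neg_cancel, zero_smul,
    gauge_zero, ← ht] at h2
  exact absurd (hK.gauge_pos hx) (not_lt.2 h2)

/-- Orthogonality means that the functional `planeDet · y` attains its norm at `x`; Cramer's rule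
turns one formulation into the other. -/
lemma birkhoffOrth_iff (hK : IsSymmConvexBody K) {x y : Plane} (hx : x ≠ 0) (hy : y ≠ 0) :
    BirkhoffOrth K x y ↔ ∀ z, |planeDet z y| * gauge K x ≤ |planeDet x y| * gauge K z := by
  constructor
  · intro h z
    rcases eq_or_ne (planeDet z y) 0 with hz | hz
    · rw [hz, abs_zero, zero_mul]
      exact mul_nonneg (abs_nonneg _) (gauge_nonneg _)
    · rw [← hK.gauge_smul (planeDet x y), planeDet_smul_eq x y z]
      have : planeDet z y • x + planeDet x z • y =
          planeDet z y • (x + (planeDet x z / planeDet z y) • y) := by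
        rw [smul_add, smul_smul, mul_div_cancel₀ _ hz]
      rw [this, hK.gauge_smul]
      exact mul_le_mul_of_nonneg_left (h _) (abs_nonneg _)
  · intro h t
    have hd : planeDet x y ≠ 0 := by
      intro h0
      -- The test vector is `y` rotated by a right angle, on which the functional does not vanish.
      have h1 := h !₂[-y 1, y 0]
      rw [h0, abs_zero, zero_mul] at h1
      have h2 : planeDet !₂[-y 1, y 0] y ≠ 0 := by
        intro h3
        simp only [planeDet, Matrix.cons_val_zero, Matrix.cons_val_one] at h3
        apply hy
        ext i; fin_cases i
        · simp; nlinarith [sq_nonneg (y 0), sq_nonneg (y 1)]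
        · simp; nlinarith [sq_nonneg (y 0), sq_nonneg (y 1)]
      exact absurd (mul_pos (abs_pos.2 h2) (hK.gauge_pos hx)) (not_lt.2 h1)
    have h1 := h (x + t • y)
    rw [planeDet_add_left, planeDet_smul_left, planeDet_self, mul_zero, add_zero] at h1
    exact le_of_mul_le_mul_left h1 (abs_pos.2 hd)

end IsSymmConvexBody

/-! ### Birkhoff orthogonality as a quarter turn. -/

/-- Birkhoff orthogonality in terms of angles. -/
def birkhoffAngle (K : Set Plane) (a b : ℝ) : Prop :=
  a < b ∧ b < a + Real.pi ∧ BirkhoffOrth K (dirVec a) (dirVec b)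

namespace IsSymmConvexBody

variable {K : Set Plane}

lemma birkhoffAngle_iff (hK : IsSymmConvexBody K) {a b : ℝ} (h1 : a < b) (h2 : b < a + Real.pi) :
    birkhoffAngle K a b ↔
      ∀ z, |planeDet z (dirVec b)| * gauge K (dirVec a) ≤ Real.sin (b - a) * gauge K z := by
  rw [birkhoffAngle, and_iff_right h1, and_iff_right h2,
    hK.birkhoffOrth_iff (dirVec_ne_zero _) (dirVec_ne_zero _), planeDet_dirVec,
    abs_of_pos (sin_pos_of_lt h1 h2)]

lemma birkhoffAngle_add_pi_iff (hK : IsSymmConvexBody K) {a b : ℝ} :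
    birkhoffAngle K (a + Real.pi) (b + Real.pi) ↔ birkhoffAngle K a b := by
  rw [birkhoffAngle, birkhoffAngle, dirVec_add_pi, dirVec_add_pi, ← neg_one_smul ℝ (dirVec a),
    ← neg_one_smul ℝ (dirVec b), hK.birkhoffOrth_smul_iff (by norm_num) (by norm_num),
    add_lt_add_iff_right, add_lt_add_iff_right]

/-- In a crossing `a < a' < b' < b`, test each norming inequality on the other direction and
multiply. The norms cancel, and what remains contradicts a Ptolemy identity for sines. -/
lemma birkhoffAngle_mono (hK : IsSymmConvexBody K) {a b a' b' : ℝ} (h : birkhoffAngle K a b)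
    (h' : birkhoffAngle K a' b') (hlt : a < a') : b ≤ b' := by
  by_contra! hn
  obtain ⟨h1, h2, -⟩ := id h
  obtain ⟨h1', h2', -⟩ := id h'
  have e := (hK.birkhoffAngle_iff h1 h2).1 h (dirVec a')
  have e' := (hK.birkhoffAngle_iff h1' h2').1 h' (dirVec a)
  have p1 := sin_pos_of_lt (show a' < b by linarith) (by linarith)
  have p2 := sin_pos_of_lt (show a < b' by linarith) (by linarith)
  have p3 := sin_pos_of_lt hlt (by linarith)
  have p4 := sin_pos_of_lt hn (by linarith)
  rw [planeDet_dirVec, abs_of_pos p1] at e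
  rw [planeDet_dirVec, abs_of_pos p2] at e'
  have hN := hK.gauge_pos (dirVec_ne_zero a)
  have hN' := hK.gauge_pos (dirVec_ne_zero a')
  have hm := mul_le_mul e e' (by positivity)
    (mul_nonneg (sin_pos_of_lt h1 h2).le hN'.le)
  have hid : Real.sin (b - a') * Real.sin (b' - a) - Real.sin (b - a) * Real.sin (b' - a') =
      Real.sin (a' - a) * Real.sin (b - b') := by
    simp only [Real.sin_sub]
    ring
  have : Real.sin (b - a') * Real.sin (b' - a) ≤ Real.sin (b - a) * Real.sin (b' - a') := by
    refine le_of_mul_le_mul_right ?_ (mul_pos hN hN')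
    linarith
  linarith [mul_pos p3 p4]

/-- The required `a` maximises the normalised determinant with `dirVec b` over a half circle;
symmetry extends the maximum to all directions. -/
lemma exists_birkhoffAngle_left (hK : IsSymmConvexBody K) (b : ℝ) :
    ∃ a, birkhoffAngle K a b := by
  have hpi := Real.pi_pos
  have hN := fun a => hK.gauge_pos (dirVec_ne_zero a)
  have hcont : Continuous fun a => Real.sin (b - a) / gauge K (dirVec a) :=
    (Real.continuous_sin.comp (continuous_const.sub continuous_id)).div
      (hK.continuous_gauge.comp continuous_dirVec) fun a => (hN a).ne'
  obtain ⟨a, ⟨ha1, ha2⟩, hmax⟩ := (isCompact_Icc (a := b - Real.pi) (b := b)).exists_isMaxOn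
    ⟨b, by linarith, le_rfl⟩ hcont.continuousOn
  have hpos : 0 < Real.sin (b - a) := by
    have h1 := hmax (show b - Real.pi / 2 ∈ Set.Icc (b - Real.pi) b by
      constructor <;> linarith)
    have h2 : 0 < Real.sin (b - (b - Real.pi / 2)) / gauge K (dirVec (b - Real.pi / 2)) := by
      rw [sub_sub_cancel, Real.sin_pi_div_two]
      exact div_pos one_pos (hN _)
    have h3 := h2.trans_le h1
    exact (div_pos_iff_of_pos_right (hN a)).1 h3
  have hab : a < b := lt_of_le_of_ne ha2 (by rintro rfl; simp at hpos)
  have hab' : b < a + Real.pi := lt_of_le_of_ne (by linarith) (by rintro rfl; simp at hpos)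
  refine ⟨a, (hK.birkhoffAngle_iff hab hab').2 fun z => ?_⟩
  have key : ∀ c ∈ Set.Icc (b - Real.pi) b, ∀ r : ℝ,
      |planeDet (r • dirVec c) (dirVec b)| * gauge K (dirVec a) ≤
        Real.sin (b - a) * gauge K (r • dirVec c) := by
    intro c hc r
    have h1 : 0 ≤ Real.sin (b - c) :=
      Real.sin_nonneg_of_nonneg_of_le_pi (by linarith [hc.2]) (by linarith [hc.1])
    have h2 : Real.sin (b - c) * gauge K (dirVec a) ≤ Real.sin (b - a) * gauge K (dirVec c) :=
      (div_le_div_iff₀ (hN c) (hN a)).1 (hmax hc)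
    rw [planeDet_smul_left, planeDet_dirVec, abs_mul, abs_of_nonneg h1, hK.gauge_smul]
    nlinarith [abs_nonneg r]
  rcases eq_or_ne z 0 with rfl | hz
  · simp [planeDet]
  obtain ⟨r, c, hr, hc1, hc2, rfl⟩ := exists_polar hz (b - Real.pi)
  rcases le_or_gt c b with h | h
  · exact key c ⟨hc1.le, h⟩ r
  · have := key (c - Real.pi) ⟨by linarith, by linarith⟩ (-r)
    rwa [dirVec_sub_pi, neg_smul_neg] at this

/-- The required `b` is the direction of a supporting line at the boundary point over `a`. -/
lemma exists_birkhoffAngle_right (hK : IsSymmConvexBody K) (a : ℝ) :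
    ∃ b, birkhoffAngle K a b := by
  have hN := hK.gauge_pos (dirVec_ne_zero a)
  set x := (gauge K (dirVec a))⁻¹ • dirVec a with hx
  have hfr : ∀ {z : Plane}, z ≠ 0 → (gauge K z)⁻¹ • z ∈ frontier K := fun {z} hz => by
    rw [← hK.gauge_eq_one_iff, hK.gauge_smul, abs_of_pos (inv_pos.2 (hK.gauge_pos hz)),
      inv_mul_cancel₀ (hK.gauge_pos hz).ne']
  have hxint : x ∉ interior K := (hfr (dirVec_ne_zero a)).2
  obtain ⟨f, hf0, hf⟩ := geometric_hahn_banach_of_nonempty_interior_point hK.convex hxint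
    hK.interior_nonempty
  have hle : ∀ z, f z ≤ f x * gauge K z := by
    intro z
    rcases eq_or_ne z 0 with rfl | hz
    · simp
    have h1 := hf _ (hK.isCompact.isClosed.frontier_subset (hfr hz))
    rw [map_smul, smul_eq_mul, inv_mul_le_iff₀ (hK.gauge_pos hz)] at h1
    linarith
  have habs : ∀ z, |f z| ≤ f x * gauge K z := fun z => abs_le'.2 ⟨hle z, by
    have := hle (-z)
    rwa [map_neg, gauge_neg hK.neg_mem] at this⟩
  have hpos : 0 < f x := by
    by_contra hn
    apply hf0
    ext z
    have h1 := habs z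
    have h2 := mul_nonpos_of_nonpos_of_nonneg (not_lt.1 hn) (gauge_nonneg (s := K) z)
    simpa using abs_nonpos_iff.1 (h1.trans h2)
  -- `w` spans the kernel of `f`, signed so that `f` is `planeDet · w`; positivity of `f x` then
  -- places its angle within `π` after `a`.
  set w : Plane := !₂[-f (EuclideanSpace.single 1 1), f (EuclideanSpace.single 0 1)] with hw
  have hfw : ∀ z, f z = planeDet z w := by
    intro z
    have : z = z 0 • EuclideanSpace.single 0 (1 : ℝ) + z 1 • EuclideanSpace.single 1 (1 : ℝ) := by
      ext i; fin_cases i <;> simp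
    conv_lhs => rw [this]
    simp only [map_add, map_smul, smul_eq_mul, planeDet, hw, PiLp.toLp_apply,
      Matrix.cons_val_zero, Matrix.cons_val_one]
    ring
  have hw0 : w ≠ 0 := by
    intro h
    rw [hfw, h] at hpos
    simp [planeDet] at hpos
  obtain ⟨s, b, hs, hb1, hb2, hwb⟩ := exists_polar hw0 a
  have hfa : f x * gauge K (dirVec a) = s * Real.sin (b - a) := by
    rw [hx, map_smul, hfw, hwb, planeDet_smul_right, planeDet_dirVec, smul_eq_mul]
    field_simp
  have hsin : 0 < Real.sin (b - a) := by
    have := mul_pos hpos hN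
    rw [hfa] at this
    exact pos_of_mul_pos_right this hs.le
  have hb3 := lt_add_pi_of_sin_pos hb2 hsin
  refine ⟨b, (hK.birkhoffAngle_iff hb1 hb3).2 fun z => ?_⟩
  have h1 := habs z
  rw [hfw, hwb, planeDet_smul_right, abs_mul, abs_of_pos hs] at h1
  refine le_of_mul_le_mul_left ?_ hs
  calc s * (|planeDet z (dirVec b)| * gauge K (dirVec a))
      = (s * |planeDet z (dirVec b)|) * gauge K (dirVec a) := by ring
    _ ≤ (f x * gauge K z) * gauge K (dirVec a) := mul_le_mul_of_nonneg_right h1 hN.le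
    _ = s * (Real.sin (b - a) * gauge K z) := by linear_combination gauge K z * hfa

lemma isQuarterTurn (hK : IsSymmConvexBody K) : IsQuarterTurn (birkhoffAngle K) where
  lt h := h.1
  lt_add_pi h := h.2.1
  add_pi_iff := hK.birkhoffAngle_add_pi_iff
  mono := hK.birkhoffAngle_mono
  total := hK.exists_birkhoffAngle_right
  surj := hK.exists_birkhoffAngle_left

/-! ### Boundary points, Auerbach points and segments in terms of angles. -/

/-- The boundary point in direction `θ`. -/
noncomputable def bdryPoint (hK : IsSymmConvexBody K) (θ : ℝ) : frontier K :=
  ⟨(gauge K (dirVec θ))⁻¹ • dirVec θ, by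
    have hN := hK.gauge_pos (dirVec_ne_zero θ)
    rw [← hK.gauge_eq_one_iff, hK.gauge_smul, abs_of_pos (inv_pos.2 hN), inv_mul_cancel₀ hN.ne']⟩

lemma coe_bdryPoint (hK : IsSymmConvexBody K) (θ : ℝ) :
    (hK.bdryPoint θ : Plane) = (gauge K (dirVec θ))⁻¹ • dirVec θ := rfl

lemma continuous_bdryPoint (hK : IsSymmConvexBody K) : Continuous hK.bdryPoint :=
  (((hK.continuous_gauge.comp continuous_dirVec).inv₀
    fun θ => (hK.gauge_pos (dirVec_ne_zero θ)).ne').smul continuous_dirVec).subtype_mk _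

lemma coe_bdryPoint_add_pi (hK : IsSymmConvexBody K) (θ : ℝ) :
    (hK.bdryPoint (θ + Real.pi) : Plane) = -hK.bdryPoint θ := by
  rw [coe_bdryPoint, coe_bdryPoint, dirVec_add_pi, gauge_neg hK.neg_mem, smul_neg]

lemma coe_bdryPoint_sub_pi (hK : IsSymmConvexBody K) (θ : ℝ) :
    (hK.bdryPoint (θ - Real.pi) : Plane) = -hK.bdryPoint θ := by
  rw [coe_bdryPoint, coe_bdryPoint, dirVec_sub_pi, gauge_neg hK.neg_mem, smul_neg]

lemma bdryPoint_add_two_pi (hK : IsSymmConvexBody K) (θ : ℝ) :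
    hK.bdryPoint (θ + 2 * Real.pi) = hK.bdryPoint θ := by
  ext1
  rw [two_mul, ← add_assoc, coe_bdryPoint_add_pi, coe_bdryPoint_add_pi, neg_neg]

lemma bdryPoint_eq_of_smul (hK : IsSymmConvexBody K) (x : frontier K) {r θ : ℝ} (hr : 0 < r)
    (h : (x : Plane) = r • dirVec θ) : x = hK.bdryPoint θ := by
  ext1
  have h1 := hK.gauge_eq_one_iff.2 x.2
  rw [h, hK.gauge_smul, abs_of_pos hr] at h1
  rw [h, coe_bdryPoint, eq_inv_of_mul_eq_one_left h1]

lemma exists_bdryPoint_eq (hK : IsSymmConvexBody K) (x : frontier K) (c : ℝ) :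
    ∃ θ, c < θ ∧ θ ≤ c + 2 * Real.pi ∧ hK.bdryPoint θ = x := by
  obtain ⟨r, θ, hr, h1, h2, h⟩ := exists_polar (hK.ne_zero_of_mem_frontier x.2) c
  exact ⟨θ, h1, h2, (hK.bdryPoint_eq_of_smul x hr h).symm⟩

lemma birkhoffOrth_bdryPoint_iff (hK : IsSymmConvexBody K) {a b : ℝ} :
    BirkhoffOrth K (hK.bdryPoint a) (hK.bdryPoint b) ↔
      BirkhoffOrth K (dirVec a) (dirVec b) :=
  hK.birkhoffOrth_smul_iff (inv_pos.2 (hK.gauge_pos (dirVec_ne_zero a))).ne'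
    (inv_pos.2 (hK.gauge_pos (dirVec_ne_zero b))).ne'

lemma birkhoffOrth_neg_right_iff (hK : IsSymmConvexBody K) {x y : Plane} :
    BirkhoffOrth K x (-y) ↔ BirkhoffOrth K x y := by
  simpa using hK.birkhoffOrth_smul_iff (x := x) (y := y) one_ne_zero (neg_ne_zero.2 one_ne_zero)

lemma birkhoffOrth_neg_left_iff (hK : IsSymmConvexBody K) {x y : Plane} :
    BirkhoffOrth K (-x) y ↔ BirkhoffOrth K x y := by
  simpa using hK.birkhoffOrth_smul_iff (x := x) (y := y) (neg_ne_zero.2 one_ne_zero) one_ne_zero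

lemma sin_sub_ne_zero (hK : IsSymmConvexBody K) {a b : ℝ}
    (h : BirkhoffOrth K (dirVec a) (dirVec b)) : Real.sin (b - a) ≠ 0 := by
  rw [← planeDet_dirVec]
  exact hK.planeDet_ne_zero (dirVec_ne_zero a) (dirVec_ne_zero b) h

lemma bdryPoint_mem_auerbachPoints_iff (hK : IsSymmConvexBody K) (a : ℝ) :
    (hK.bdryPoint a : Plane) ∈ auerbachPoints K ↔ a ∈ squareFixed (birkhoffAngle K) := by
  constructor
  · rintro ⟨-, y, hy, h1, h2⟩
    obtain ⟨b, hb1, hb2, hb⟩ := hK.exists_bdryPoint_eq ⟨y, hy⟩ a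
    have hb' : (hK.bdryPoint b : Plane) = y := congrArg Subtype.val hb
    rw [← hb', hK.birkhoffOrth_bdryPoint_iff] at h1 h2
    have hs := hK.sin_sub_ne_zero h1
    rcases lt_trichotomy b (a + Real.pi) with h | h | h
    · refine ⟨b, ⟨hb1, h, h1⟩, h, by linarith, ?_⟩
      rwa [dirVec_add_pi, hK.birkhoffOrth_neg_right_iff]
    · simp [h] at hs
    · have hne : b ≠ a + 2 * Real.pi := by
        rintro rfl; simp at hs
      have hlt := lt_of_le_of_ne hb2 hne
      -- When `y` lies beyond the antipode, `-y` serves instead.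
      refine ⟨b - Real.pi, ⟨by linarith, by linarith, ?_⟩, by linarith, by linarith, ?_⟩
      · rwa [dirVec_sub_pi, hK.birkhoffOrth_neg_right_iff]
      · rwa [dirVec_sub_pi, dirVec_add_pi, hK.birkhoffOrth_neg_right_iff,
          hK.birkhoffOrth_neg_left_iff]
  · rintro ⟨b, ⟨-, -, h1⟩, -, -, h2⟩
    rw [dirVec_add_pi, hK.birkhoffOrth_neg_right_iff] at h2
    exact ⟨(hK.bdryPoint a).2, _, (hK.bdryPoint b).2, hK.birkhoffOrth_bdryPoint_iff.2 h1,
      hK.birkhoffOrth_bdryPoint_iff.2 h2⟩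

/-- The norm is constant near `z` along the line of the segment, and by convexity a local minimum is
global. In the triangle inequality below, `(1 + s) • z` is split into the moved point scaled by `s`
and another point of the segment. -/
lemma birkhoffOrth_of_mem_openSegment (hK : IsSymmConvexBody K) {a b z : Plane}
    (hab : openSegment ℝ a b ⊆ frontier K) (hz : z ∈ openSegment ℝ a b) :
    BirkhoffOrth K z (b - a) := by
  intro t
  rw [openSegment_eq_image_lineMap] at hz hab
  obtain ⟨u, hu, rfl⟩ := hz
  obtain ⟨s, hs, hsu⟩ : ∃ s : ℝ, 0 < s ∧ u - s * t ∈ Set.Ioo (0 : ℝ) 1 := by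
    have hc : Filter.Tendsto (fun s : ℝ => u - s * t) (nhds 0) (nhds u) := by
      have : Continuous fun s : ℝ => u - s * t := by fun_prop
      simpa using this.tendsto 0
    have h1 : ∀ᶠ s in nhdsWithin (0 : ℝ) (Set.Ioi 0), u - s * t ∈ Set.Ioo (0 : ℝ) 1 :=
      (hc.eventually (Ioo_mem_nhds hu.1 hu.2)).filter_mono nhdsWithin_le_nhds
    obtain ⟨s, hs1, hs2⟩ := (h1.and self_mem_nhdsWithin).exists
    exact ⟨s, hs2, hs1⟩
  have e1 := hK.gauge_eq_one_iff.2 (hab ⟨_, hu, rfl⟩)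
  have e2 := hK.gauge_eq_one_iff.2 (hab ⟨_, hsu, rfl⟩)
  have e3 := hK.gauge_add_le (s • (AffineMap.lineMap a b u + t • (b - a)))
    (AffineMap.lineMap a b (u - s * t))
  have : s • (AffineMap.lineMap a b u + t • (b - a)) + AffineMap.lineMap a b (u - s * t) =
      (1 + s) • (AffineMap.lineMap a b u : Plane) := by
    simp only [AffineMap.lineMap_apply_module']
    module
  rw [this, hK.gauge_smul, hK.gauge_smul, e1, e2, abs_of_pos hs, abs_of_pos (by linarith)] at e3
  rw [e1]
  refine le_of_mul_le_mul_left ?_ hs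
  linarith

/-- All points of a boundary segment are orthogonal to its direction, so their angles share a fibre.
Conversely, two angles with the common value `φ` give boundary points on one supporting line of
direction `φ`, and the chord between them stays in the boundary. -/
lemma bdryPoint_mem_openSegmentUnion_iff (hK : IsSymmConvexBody K) (θ : ℝ) :
    (hK.bdryPoint θ : Plane) ∈ openSegmentUnion K ↔ θ ∈ flatPoints (birkhoffAngle K) := by
  constructor
  · rintro ⟨a, b, hab, hsub, hx⟩
    wlog hpos : 0 ≤ planeDet (dirVec θ) (b - a) generalizing a b
    · refine this b a hab.symm (by rwa [openSegment_symm]) (by rwa [openSegment_symm]) ?_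
      have : a - b = (-1 : ℝ) • (b - a) := by module
      rw [this, planeDet_smul_right]
      linarith
    have hd0 : b - a ≠ 0 := sub_ne_zero.2 hab.symm
    have hN := hK.gauge_pos (dirVec_ne_zero θ)
    have hdet : 0 < planeDet (dirVec θ) (b - a) := by
      refine lt_of_le_of_ne hpos (Ne.symm ?_)
      have h1 := hK.birkhoffOrth_of_mem_openSegment hsub hx
      have h2 := hK.birkhoffOrth_smul h1 (gauge K (dirVec θ)) 1
      rw [coe_bdryPoint, smul_smul, mul_inv_cancel₀ hN.ne', one_smul, one_smul] at h2
      exact hK.planeDet_ne_zero (dirVec_ne_zero θ) hd0 h2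
    obtain ⟨r, φ, hr, hφ1, hφ2, hd⟩ := exists_polar hd0 θ
    have hsin : 0 < Real.sin (φ - θ) := by
      rw [hd, planeDet_smul_right, planeDet_dirVec] at hdet
      exact pos_of_mul_pos_right hdet hr.le
    have hφ3 := lt_add_pi_of_sin_pos hφ2 hsin
    -- The sign of `s` decides on which side of `θ` the angle `g` lies; one point of the segment on
    -- each side of the given one will be used.
    have key : ∀ z ∈ openSegment ℝ a b, ∀ s : ℝ, z = hK.bdryPoint θ + s • (b - a) →
        ∃ g, φ - Real.pi < g ∧ birkhoffAngle K g φ ∧ ∃ q > 0,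
          q * Real.sin (g - θ) = s * planeDet (dirVec θ) (b - a) := by
      intro z hz s hzs
      obtain ⟨q, g, hq, hg1, hg2, hzq⟩ := exists_polar
        (hK.ne_zero_of_mem_frontier (hsub hz)) (φ - 2 * Real.pi)
      have hB := hK.birkhoffOrth_of_mem_openSegment hsub hz
      have hdz : planeDet z (dirVec φ) = (gauge K (dirVec θ))⁻¹ * Real.sin (φ - θ) := by
        rw [hzs, planeDet_add_left, coe_bdryPoint, planeDet_smul_left, planeDet_dirVec, hd,
          planeDet_smul_left, planeDet_smul_left, planeDet_self]
        ring
      have hsg : 0 < Real.sin (φ - g) := by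
        rw [hzq, planeDet_smul_left, planeDet_dirVec] at hdz
        have : 0 < q * Real.sin (φ - g) := hdz ▸ mul_pos (inv_pos.2 hN) hsin
        exact pos_of_mul_pos_right this hq.le
      have hgφ : g < φ := lt_of_le_of_ne (by linarith) (by rintro rfl; simp at hsg)
      have hg3 : φ < g + Real.pi := lt_add_pi_of_sin_pos (by linarith) hsg
      refine ⟨g, by linarith, ⟨hgφ, hg3, ?_⟩, q, hq, ?_⟩
      · rwa [hzq, hd, hK.birkhoffOrth_smul_iff hq.ne' hr.ne'] at hB
      · have h1 : planeDet (dirVec θ) z = s * planeDet (dirVec θ) (b - a) := by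
          rw [hzs, planeDet_comm, planeDet_add_left, coe_bdryPoint, planeDet_smul_left,
            planeDet_self, planeDet_smul_left, planeDet_comm (dirVec θ)]
          ring
        rw [← h1, hzq, planeDet_smul_right, planeDet_dirVec]
    rw [openSegment_eq_image_lineMap] at hx
    obtain ⟨u, hu, hxu⟩ := hx
    have hmem : ∀ v ∈ Set.Ioo (0 : ℝ) 1, AffineMap.lineMap a b v ∈ openSegment ℝ a b := fun v hv => by
      rw [openSegment_eq_image_lineMap]; exact ⟨v, hv, rfl⟩
    have hshift : ∀ v : ℝ, AffineMap.lineMap a b v = hK.bdryPoint θ + (v - u) • (b - a) := by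
      intro v
      rw [← hxu]
      simp only [AffineMap.lineMap_apply_module']
      module
    obtain ⟨g₁, hg₁, hB₁, q₁, hq₁, e₁⟩ :=
      key _ (hmem (u / 2) ⟨by linarith [hu.1], by linarith [hu.2]⟩) _ (hshift _)
    obtain ⟨g₂, hg₂, hB₂, q₂, hq₂, e₂⟩ :=
      key _ (hmem ((u + 1) / 2) ⟨by linarith [hu.1], by linarith [hu.2]⟩) _ (hshift _)
    refine ⟨g₁, g₂, φ, ?_, ?_, hB₁, hB₂⟩
    · by_contra! hn
      have h1 : 0 ≤ Real.sin (g₁ - θ) :=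
        Real.sin_nonneg_of_nonneg_of_le_pi (by linarith) (by linarith [hB₁.1])
      have h2 : (u / 2 - u) * planeDet (dirVec θ) (b - a) < 0 :=
        mul_neg_of_neg_of_pos (by linarith [hu.1]) hdet
      linarith [mul_nonneg hq₁.le h1]
    · by_contra! hn
      have h1 : 0 ≤ Real.sin (θ - g₂) :=
        Real.sin_nonneg_of_nonneg_of_le_pi (by linarith) (by linarith [hB₂.1])
      rw [← neg_sub, Real.sin_neg] at h1
      have h2 : 0 < ((u + 1) / 2 - u) * planeDet (dirVec θ) (b - a) :=
        mul_pos (by linarith [hu.2]) hdet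
      nlinarith
  · rintro ⟨g₁, g₃, φ, h1, h3, hg₁, hg₃⟩
    obtain ⟨l₁, u₁, -⟩ := id hg₁
    obtain ⟨l₃, u₃, -⟩ := id hg₃
    have hB₁ := (hK.birkhoffAngle_iff l₁ u₁).1 hg₁
    have hB₃ := (hK.birkhoffAngle_iff l₃ u₃).1 hg₃
    have hs₁ := sin_pos_of_lt l₁ u₁
    have hs₃ := sin_pos_of_lt l₃ u₃
    have hN₁ := hK.gauge_pos (dirVec_ne_zero g₁)
    have hN₃ := hK.gauge_pos (dirVec_ne_zero g₃)
    -- Each norming inequality tested at the other direction: both boundary points attain the same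
    -- maximum.
    have heq : Real.sin (φ - g₃) * gauge K (dirVec g₁) =
        Real.sin (φ - g₁) * gauge K (dirVec g₃) := by
      have e1 := hB₁ (dirVec g₃)
      have e3 := hB₃ (dirVec g₁)
      rw [planeDet_dirVec, abs_of_pos hs₃] at e1
      rw [planeDet_dirVec, abs_of_pos hs₁] at e3
      exact le_antisymm e1 e3
    have hfr : openSegment ℝ (hK.bdryPoint g₁ : Plane) (hK.bdryPoint g₃) ⊆ frontier K := by
      rintro _ ⟨s, t, hs, ht, hst, rfl⟩
      rw [← hK.gauge_eq_one_iff]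
      apply le_antisymm
      · refine (hK.gauge_add_le _ _).trans ?_
        rw [hK.gauge_smul, hK.gauge_smul, hK.gauge_eq_one_iff.2 (hK.bdryPoint g₁).2,
          hK.gauge_eq_one_iff.2 (hK.bdryPoint g₃).2, abs_of_pos hs, abs_of_pos ht]
        linarith
      · have e := hB₁ (s • (hK.bdryPoint g₁ : Plane) + t • (hK.bdryPoint g₃ : Plane))
        have hdet : planeDet (s • (hK.bdryPoint g₁ : Plane) + t • (hK.bdryPoint g₃ : Plane))
            (dirVec φ) * gauge K (dirVec g₁) = Real.sin (φ - g₁) := by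
          rw [planeDet_add_left, planeDet_smul_left, planeDet_smul_left, coe_bdryPoint,
            coe_bdryPoint, planeDet_smul_left, planeDet_smul_left, planeDet_dirVec,
            planeDet_dirVec]
          field_simp
          linear_combination t * heq + Real.sin (φ - g₁) * gauge K (dirVec g₃) * hst
        have h4 : Real.sin (φ - g₁) ≤ Real.sin (φ - g₁) *
            gauge K (s • (hK.bdryPoint g₁ : Plane) + t • (hK.bdryPoint g₃ : Plane)) := by
          refine le_trans ?_ e
          rw [← hdet]
          exact mul_le_mul_of_nonneg_right (le_abs_self _) hN₁.le
        exact le_of_mul_le_mul_left (by simpa using h4) hs₁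
    have p1 := sin_pos_of_lt h1 (by linarith)
    have p2 := sin_pos_of_lt h3 (by linarith)
    have p3 := sin_pos_of_lt (h1.trans h3) (by linarith)
    -- By Cramer's rule these are, up to normalisation, the weights of the point where the ray at
    -- `θ` meets the chord.
    set α := Real.sin (g₃ - θ) * gauge K (dirVec g₁) with hα
    set β := Real.sin (θ - g₁) * gauge K (dirVec g₃) with hβ
    have hαpos : 0 < α := mul_pos p2 hN₁
    have hβpos : 0 < β := mul_pos p1 hN₃
    have hcomb : (α / (α + β)) • (hK.bdryPoint g₁ : Plane) + (β / (α + β)) •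
        (hK.bdryPoint g₃ : Plane) = (Real.sin (g₃ - g₁) / (α + β)) • dirVec θ := by
      have hc := planeDet_smul_eq (dirVec g₁) (dirVec g₃) (dirVec θ)
      simp only [planeDet_dirVec] at hc
      rw [div_eq_inv_mul (Real.sin _), mul_smul, hc, coe_bdryPoint, coe_bdryPoint, smul_add,
        smul_smul, smul_smul, smul_smul, smul_smul, hα, hβ]
      congr 2 <;> field_simp
    have hmem : (Real.sin (g₃ - g₁) / (α + β)) • dirVec θ ∈
        openSegment ℝ (hK.bdryPoint g₁ : Plane) (hK.bdryPoint g₃) :=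
      ⟨α / (α + β), β / (α + β), by positivity, by positivity, by field_simp, hcomb⟩
    have hpt := hK.bdryPoint_eq_of_smul ⟨_, hfr hmem⟩ (div_pos p3 (by positivity)) rfl
    refine ⟨_, _, fun hne => ?_, hfr, by rw [← hpt]; exact hmem⟩
    have h4 := congrArg (planeDet (dirVec g₁)) hne
    rw [coe_bdryPoint, coe_bdryPoint, planeDet_smul_right, planeDet_smul_right, planeDet_self,
      planeDet_dirVec, mul_zero] at h4
    exact (mul_pos (inv_pos.2 hN₃) p3).ne h4

/-- A projection of a compact set of pairs. This supplies the Borel measurability that the staircase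
needs. -/
lemma isClosed_auerbachPoints (hK : IsSymmConvexBody K) : IsClosed (auerbachPoints K) := by
  have hc := hK.continuous_gauge
  have hcl : IsClosed {q : Plane × Plane | BirkhoffOrth K q.1 q.2 ∧ BirkhoffOrth K q.2 q.1} := by
    have h1 : IsClosed {q : Plane × Plane | BirkhoffOrth K q.1 q.2} := by
      simp only [BirkhoffOrth, Set.ofPred_forall]
      exact isClosed_iInter fun t => isClosed_le (by fun_prop) (by fun_prop)
    exact h1.inter (h1.preimage continuous_swap)
  have hfr : IsCompact (frontier K) :=
    hK.isCompact.of_isClosed_subset isClosed_frontier hK.isCompact.isClosed.frontier_subset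
  convert (((hfr.prod hfr).inter_right hcl).image continuous_fst).isClosed using 1
  ext x
  simp only [auerbachPoints, Set.mem_image, Set.mem_inter_iff, Set.mem_prod]
  constructor
  · rintro ⟨hx, y, hy, h1, h2⟩
    exact ⟨(x, y), ⟨⟨hx, hy⟩, h1, h2⟩, rfl⟩
  · rintro ⟨⟨x, y⟩, ⟨⟨hx, hy⟩, h1, h2⟩, rfl⟩
    exact ⟨hx, y, hy, h1, h2⟩

lemma measurableSet_squareFixed (hK : IsSymmConvexBody K) :
    MeasurableSet (squareFixed (birkhoffAngle K)) := by
  have h := (hK.isClosed_auerbachPoints.preimage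
    (continuous_subtype_val.comp hK.continuous_bdryPoint)).measurableSet
  convert h using 1
  ext a
  exact (hK.bdryPoint_mem_auerbachPoints_iff a).symm

lemma bdryPoint_injOn (hK : IsSymmConvexBody K) (c : ℝ) :
    Set.InjOn hK.bdryPoint (Set.Ioc c (c + 2 * Real.pi)) := by
  have key : ∀ a b, c < a → b ≤ c + 2 * Real.pi → a < b → hK.bdryPoint a ≠ hK.bdryPoint b := by
    intro a b ha hb hab h
    have h' : (hK.bdryPoint a : Plane) = hK.bdryPoint b := congrArg Subtype.val h
    have h1 := congrArg (planeDet (dirVec a)) h'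
    have hNb := inv_pos.2 (hK.gauge_pos (dirVec_ne_zero b))
    rw [coe_bdryPoint, coe_bdryPoint, planeDet_smul_right, planeDet_smul_right, planeDet_self,
      planeDet_dirVec, mul_zero, zero_eq_mul, or_iff_right hNb.ne'] at h1
    rcases lt_trichotomy b (a + Real.pi) with hlt | rfl | hlt
    · exact (sin_pos_of_lt hab hlt).ne' h1
    · rw [coe_bdryPoint_add_pi] at h'
      have h2 : (2 : ℝ) • (hK.bdryPoint a : Plane) = 0 := by
        rw [two_smul]; exact add_eq_zero_iff_eq_neg.2 h'
      exact hK.ne_zero_of_mem_frontier (hK.bdryPoint a).2 (by simpa using h2)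
    · have := sin_pos_of_lt (show a + Real.pi < b from hlt) (by linarith)
      rw [← sub_sub, Real.sin_sub_pi, h1] at this
      simp at this
  intro a ha b hb h
  rcases lt_trichotomy a b with hlt | heq | hlt
  · exact absurd h (key a b ha.1 hb.2 hlt)
  · exact heq
  · exact absurd h.symm (key b a hb.1 ha.2 hlt)

end IsSymmConvexBody

/-! ### Null subarcs and closed arcs of the boundary. -/

/-- A branch of the polar angle, continuous off the ray opposite to direction `a`. -/
lemma exists_continuous_angle (a : ℝ) : ∃ f : Plane → ℝ,
    ∀ θ ∈ Set.Ioo (a - Real.pi) (a + Real.pi), ∀ r : ℝ, 0 < r →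
      f (r • dirVec θ) = θ ∧ ContinuousAt f (r • dirVec θ) := by
  -- Rotation by `-a` moves the branch cut of `Complex.arg` to the direction opposite to `a`.
  let g : Plane → ℂ := fun x => ((x 0 : ℂ) + x 1 * Complex.I) *
    (Complex.cos (a : ℂ) - Complex.sin (a : ℂ) * Complex.I)
  have hg : Continuous g := by fun_prop
  refine ⟨fun x => a + (g x).arg, fun θ hθ r hr => ?_⟩
  have hgr : g (r • dirVec θ) = r * (Complex.cos ((θ - a : ℝ) : ℂ) +
      Complex.sin ((θ - a : ℝ) : ℂ) * Complex.I) := by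
    simp only [g, PiLp.smul_apply, dirVec_zero_coord, dirVec_one_coord, smul_eq_mul]
    push_cast
    rw [Complex.cos_sub, Complex.sin_sub]
    linear_combination (-r * Complex.sin θ * Complex.sin a) * Complex.I_sq
  have harg : (g (r • dirVec θ)).arg = θ - a := by
    rw [hgr]
    exact Complex.arg_mul_cos_add_sin_mul_I hr ⟨by linarith [hθ.1], by linarith [hθ.2]⟩
  refine ⟨by simp only [harg]; ring, ?_⟩
  refine continuousAt_const.add (ContinuousAt.comp (f := g) (Complex.continuousAt_arg ?_)
    hg.continuousAt)
  rw [Complex.mem_slitPlane_iff_arg, harg]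
  refine ⟨by linarith [hθ.2], fun h => ?_⟩
  rw [h, Complex.arg_zero] at harg
  rw [h, ← harg] at hgr
  simp only [Complex.ofReal_zero, Complex.cos_zero, Complex.sin_zero, zero_mul, add_zero,
    mul_one] at hgr
  exact hr.ne (by exact_mod_cast hgr)

lemma range_eq_uIcc_of_injective {f : unitInterval → ℝ} (hf : Continuous f)
    (hi : Function.Injective f) : Set.range f = Set.uIcc (f 0) (f 1) := by
  rcases hf.strictMono_of_inj hi with hm | hm
  · rw [Set.uIcc_of_le (hm.monotone unitInterval.nonneg')]
    refine Set.Subset.antisymm ?_ (intermediate_value_univ 0 1 hf)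
    rintro _ ⟨t, rfl⟩
    exact ⟨hm.monotone unitInterval.nonneg', hm.monotone unitInterval.le_one'⟩
  · rw [Set.uIcc_of_ge (hm.antitone unitInterval.nonneg')]
    refine Set.Subset.antisymm ?_ (intermediate_value_univ 1 0 hf)
    rintro _ ⟨t, rfl⟩
    exact ⟨hm.antitone unitInterval.le_one', hm.antitone unitInterval.nonneg'⟩

/-- For an atomless measure, the points of a curve that are end points of negligible subarcs form
a negligible set. -/
lemma measure_image_endpoints_eq_zero {X : Type*} [MeasurableSpace X] (μ : Measure X)
    (hμ : ∀ x, μ {x} = 0) (p : ℝ → X) :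
    μ (p '' {a | ∃ b, a < b ∧ μ (p '' Set.Icc a b) = 0 ∨ b < a ∧ μ (p '' Set.Icc b a) = 0}) = 0 := by
  -- Null arcs with rational ends; there are countably many.
  set U : Set X := ⋃ q : {q : ℚ × ℚ // μ (p '' Set.Icc (q.1 : ℝ) q.2) = 0},
    p '' Set.Icc (q.1.1 : ℝ) q.1.2 with hU
  have hU0 : μ U = 0 := measure_iUnion_null fun q => q.2
  have hcount : ∀ T : Set ℝ, T.Countable → μ (p '' T) = 0 := fun T hT => by
    rw [← Set.biUnion_of_singleton (p '' T)]
    exact (measure_biUnion_null_iff (hT.image p)).2 fun x _ => hμ x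
  have hmem : ∀ {q q' : ℚ} {a : ℝ}, μ (p '' Set.Icc (q : ℝ) q') = 0 → a ∈ Set.Icc (q : ℝ) q' →
      p a ∈ U := fun {q q' a} h ha => Set.mem_iUnion.2 ⟨⟨(q, q'), h⟩, a, ha, rfl⟩
  have hsub : ∀ {a b a' b' : ℝ}, μ (p '' Set.Icc a b) = 0 → a ≤ a' → b' ≤ b →
      μ (p '' Set.Icc a' b') = 0 := fun h h1 h2 =>
    measure_mono_null (Set.image_mono (Set.Icc_subset_Icc h1 h2)) h
  -- For each rational `q` at most one left end escapes `U`: of two, the one nearer to `q` lies in a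
  -- null arc with rational ends.
  have h1 : (⋃ q : ℚ, {a : ℝ | a < q ∧ μ (p '' Set.Icc a q) = 0 ∧ p a ∉ U}).Countable := by
    refine Set.countable_iUnion fun q => Set.Subsingleton.countable ?_
    have key : ∀ a a' : ℝ, a < a' → a' < q → μ (p '' Set.Icc a q) = 0 → p a' ∈ U := by
      intro a a' haa' ha'q h
      obtain ⟨s, hs1, hs2⟩ := exists_rat_btwn haa'
      exact hmem (hsub h hs1.le le_rfl) ⟨hs2.le, ha'q.le⟩
    rintro a ⟨ha, ha0, haU⟩ a' ⟨ha', ha0', haU'⟩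
    rcases lt_trichotomy a a' with h | h | h
    · exact absurd (key a a' h ha' ha0) haU'
    · exact h
    · exact absurd (key a' a h ha ha0') haU
  have h2 : (⋃ q : ℚ, {a : ℝ | q < a ∧ μ (p '' Set.Icc q a) = 0 ∧ p a ∉ U}).Countable := by
    refine Set.countable_iUnion fun q => Set.Subsingleton.countable ?_
    have key : ∀ a a' : ℝ, a' < a → q < a' → μ (p '' Set.Icc q a) = 0 → p a' ∈ U := by
      intro a a' haa' ha'q h
      obtain ⟨s, hs1, hs2⟩ := exists_rat_btwn haa'
      exact hmem (hsub h le_rfl hs2.le) ⟨ha'q.le, hs1.le⟩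
    rintro a ⟨ha, ha0, haU⟩ a' ⟨ha', ha0', haU'⟩
    rcases lt_trichotomy a a' with h | h | h
    · exact absurd (key a' a h ha ha0') haU
    · exact h
    · exact absurd (key a a' h ha' ha0) haU'
  refine measure_mono_null ?_ (measure_union_null hU0 (hcount _ (h1.union h2)))
  rintro _ ⟨a, ⟨b, hb⟩, rfl⟩
  by_cases haU : p a ∈ U
  · exact Or.inl haU
  refine Or.inr ⟨a, ?_, rfl⟩
  rcases hb with ⟨hab, h0⟩ | ⟨hab, h0⟩
  · obtain ⟨s, hs1, hs2⟩ := exists_rat_btwn hab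
    exact Or.inl (Set.mem_iUnion.2 ⟨s, hs1, hsub h0 le_rfl hs2.le, haU⟩)
  · obtain ⟨s, hs1, hs2⟩ := exists_rat_btwn hab
    exact Or.inr (Set.mem_iUnion.2 ⟨s, hs2, hsub h0 hs1.le le_rfl, haU⟩)

namespace IsSymmConvexBody

variable {K : Set Plane}

/-- An arc from `p a` to `p b` that avoids the antipode of `p a` is the obvious one. -/
lemma isClosedArc_eq (hK : IsSymmConvexBody K) {C : Set (frontier K)} {a b : ℝ}
    (hC : IsClosedArc K C (hK.bdryPoint a) (hK.bdryPoint b)) (hno : NoOppositePoints K C)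
    (hb : b ∈ Set.Ioo (a - Real.pi) (a + Real.pi)) : C = hK.bdryPoint '' Set.uIcc a b := by
  have hpi := Real.pi_pos
  obtain ⟨γ, hγ, hinj, h0, h1, rfl⟩ := hC
  obtain ⟨f, hf⟩ := exists_continuous_angle a
  have hpos : ∀ θ, 0 < (gauge K (dirVec θ))⁻¹ := fun θ => inv_pos.2 (hK.gauge_pos (dirVec_ne_zero θ))
  -- Avoiding the antipode of the starting point keeps the angle inside the domain of the branch
  -- `f`, so `γ` lifts to an injective real path.
  have hang : ∀ t, ∃ θ ∈ Set.Ioo (a - Real.pi) (a + Real.pi), hK.bdryPoint θ = γ t := by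
    intro t
    obtain ⟨θ, hθ1, hθ2, hθ⟩ := hK.exists_bdryPoint_eq (γ t) (a - Real.pi)
    refine ⟨θ, ⟨hθ1, lt_of_le_of_ne (by linarith) fun h => ?_⟩, hθ⟩
    refine hno (γ 0) ⟨0, rfl⟩ (γ t) ⟨t, rfl⟩ ?_
    rw [← hθ, h, h0, hK.coe_bdryPoint_add_pi]
  choose θ hθmem hθ using hang
  have hfθ : ∀ t, f (γ t) = θ t := fun t => by
    rw [← hθ t]; exact (hf _ (hθmem t) _ (hpos _)).1
  have hcont : Continuous fun t => f (γ t) := by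
    rw [continuous_iff_continuousAt]
    intro t
    have h2 : ContinuousAt f (γ t : Plane) := by
      rw [← hθ t]; exact (hf _ (hθmem t) _ (hpos _)).2
    exact ContinuousAt.comp (f := fun t => (γ t : Plane)) h2
      (continuous_subtype_val.comp hγ).continuousAt
  have hinj' : Function.Injective fun t => f (γ t) := by
    intro s t hst
    simp only [hfθ] at hst
    exact hinj (by rw [← hθ s, ← hθ t, hst])
  have hr := range_eq_uIcc_of_injective hcont hinj'
  have e0 : f (γ 0) = a := by
    rw [h0]; exact (hf a ⟨by linarith, by linarith⟩ _ (hpos _)).1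
  have e1 : f (γ 1) = b := by
    rw [h1]; exact (hf b hb _ (hpos _)).1
  rw [e0, e1] at hr
  rw [← hr, ← Set.range_comp]
  congr 1
  ext1 t
  rw [Function.comp_apply, hfθ, hθ]

lemma isClosedArc_image_Icc (hK : IsSymmConvexBody K) {a b : ℝ} (hab : a < b)
    (hb : b < a + 2 * Real.pi) :
    IsClosedArc K (hK.bdryPoint '' Set.Icc a b) (hK.bdryPoint a) (hK.bdryPoint b) := by
  have himg : (fun t : ℝ => a + t * (b - a)) '' Set.Icc 0 1 = Set.Icc a b := by
    have := Set.image_affine_Icc' (sub_pos.2 hab) a 0 1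
    simpa [mul_comm, add_comm] using this
  refine ⟨fun t => hK.bdryPoint (a + t * (b - a)), hK.continuous_bdryPoint.comp (by fun_prop),
    fun s t hst => ?_, by simp, by simp, ?_⟩
  · have hmem : ∀ t : unitInterval, a + t * (b - a) ∈
        Set.Ioc (b - 2 * Real.pi) (b - 2 * Real.pi + 2 * Real.pi) := by
      intro t
      have : a + (t : ℝ) * (b - a) ∈ Set.Icc a b := himg ▸ Set.mem_image_of_mem _ t.2
      exact ⟨by linarith [this.1], by linarith [this.2]⟩
    have h := hK.bdryPoint_injOn _ (hmem s) (hmem t) hst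
    have h2 : (s : ℝ) * (b - a) = t * (b - a) := by linarith
    exact Subtype.ext (mul_right_cancel₀ (sub_pos.2 hab).ne' h2)
  · rw [← himg, Set.image_image]
    ext x
    simp [unitInterval]

lemma noOppositePoints_image_Icc (hK : IsSymmConvexBody K) {a b : ℝ} (hb : b < a + Real.pi) :
    NoOppositePoints K (hK.bdryPoint '' Set.Icc a b) := by
  rintro _ ⟨s, hs, rfl⟩ _ ⟨t, ht, rfl⟩ h
  rw [← hK.coe_bdryPoint_add_pi] at h
  have := hK.bdryPoint_injOn (b - Real.pi) (x₁ := t) (x₂ := s + Real.pi)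
    ⟨by linarith [ht.1], by linarith [ht.2, Real.pi_pos]⟩
    ⟨by linarith [hs.1, Real.pi_pos], by linarith [hs.2]⟩ (Subtype.ext h)
  linarith [ht.2, hs.1]

lemma negSet_image_Icc (hK : IsSymmConvexBody K) (a b : ℝ) :
    negSet K (hK.bdryPoint '' Set.Icc a b) =
      hK.bdryPoint '' Set.Icc (a + Real.pi) (b + Real.pi) := by
  ext z
  constructor
  · rintro ⟨_, ⟨s, hs, rfl⟩, hz⟩
    refine ⟨s + Real.pi, ⟨by linarith [hs.1], by linarith [hs.2]⟩, Subtype.ext ?_⟩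
    rw [hz, hK.coe_bdryPoint_add_pi]
  · rintro ⟨s, hs, rfl⟩
    refine ⟨_, ⟨s - Real.pi, ⟨by linarith [hs.1], by linarith [hs.2]⟩, rfl⟩, ?_⟩
    rw [hK.coe_bdryPoint_sub_pi, neg_neg]

lemma measurableSet_image_Icc (hK : IsSymmConvexBody K) (a b : ℝ) :
    MeasurableSet (hK.bdryPoint '' Set.Icc a b) :=
  (isCompact_Icc.image hK.continuous_bdryPoint).isClosed.measurableSet

end IsSymmConvexBody

/-! ### From a B-measure to uncountably many points. -/

namespace IsAngularMeasure

variable {K : Set Plane} {μ : Measure (frontier K)}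

/-- The two arcs meet at most in the points over `a` and `b`, the former when the arcs close up;
points are null. -/
lemma measure_image_Icc_add (hμ : IsAngularMeasure K μ) (hK : IsSymmConvexBody K) {a b c : ℝ}
    (hab : a ≤ b) (hbc : b ≤ c) (hc : c ≤ a + 2 * Real.pi) :
    μ (hK.bdryPoint '' Set.Icc a c) =
      μ (hK.bdryPoint '' Set.Icc a b) + μ (hK.bdryPoint '' Set.Icc b c) := by
  rw [← Set.Icc_union_Icc_eq_Icc hab hbc, Set.image_union]
  refine measure_union₀ (hK.measurableSet_image_Icc b c).nullMeasurableSet ?_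
  refine measure_mono_null (t := {hK.bdryPoint a} ∪ {hK.bdryPoint b}) ?_
    (measure_union_null (hμ.continuous _) (hμ.continuous _))
  rintro _ ⟨⟨s, hs, rfl⟩, t, ht, hst⟩
  rcases hs.1.eq_or_lt with rfl | has
  · exact Or.inl rfl
  · right
    have := hK.bdryPoint_injOn a ⟨has, by linarith [hs.2, ht.1, ht.2]⟩
      ⟨by linarith [hs.2, ht.1], by linarith [ht.2]⟩ hst.symm
    rw [show s = b by linarith [hs.2, ht.1]]
    rfl

lemma measure_image_Icc_add_pi (hμ : IsAngularMeasure K μ) (hK : IsSymmConvexBody K) (a b : ℝ) :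
    μ (hK.bdryPoint '' Set.Icc (a + Real.pi) (b + Real.pi)) = μ (hK.bdryPoint '' Set.Icc a b) := by
  rw [← hK.negSet_image_Icc, hμ.symm _ (hK.measurableSet_image_Icc a b)]

lemma measure_half (hμ : IsAngularMeasure K μ) (hK : IsSymmConvexBody K) (a : ℝ) :
    μ (hK.bdryPoint '' Set.Icc a (a + Real.pi)) = ENNReal.ofReal Real.pi := by
  have hpi := Real.pi_pos
  have h1 : hK.bdryPoint '' Set.Icc a (a + 2 * Real.pi) = Set.univ := by
    refine Set.eq_univ_of_forall fun x => ?_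
    obtain ⟨θ, h1, h2, h⟩ := hK.exists_bdryPoint_eq x a
    exact ⟨θ, ⟨h1.le, h2⟩, h⟩
  have h2 := hμ.measure_image_Icc_add hK (show a ≤ a + Real.pi by linarith)
    (show a + Real.pi ≤ a + 2 * Real.pi by linarith) le_rfl
  rw [h1, hμ.total, show a + 2 * Real.pi = a + Real.pi + Real.pi by ring,
    hμ.measure_image_Icc_add_pi hK, ← two_mul, ENNReal.ofReal_mul zero_le_two,
    ENNReal.ofReal_ofNat] at h2
  exact ((ENNReal.mul_right_inj two_ne_zero ENNReal.ofNat_ne_top).1 h2).symm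

end IsAngularMeasure

namespace IsBMeasure

variable {K : Set Plane} {μ : Measure (frontier K)}

lemma measure_quarter (hμ : IsBMeasure K μ) (hK : IsSymmConvexBody K) {a b : ℝ}
    (h : birkhoffAngle K a b) :
    μ (hK.bdryPoint '' Set.Icc a b) = ENNReal.ofReal (Real.pi / 2) :=
  hμ.arc _ _ _ (hK.isClosedArc_image_Icc h.1 (by linarith [h.2.1, Real.pi_pos]))
    (hK.noOppositePoints_image_Icc h.2.1) (hK.birkhoffOrth_bdryPoint_iff.2 h.2.2)

/-- At a flat angle, two quarter arcs with the same far end have equal mass, so their difference is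
null. Otherwise the quarter arcs from `a` to `b` to `c` have total mass `π`, as does the half turn
from `a`. The arc between `c` and `a + π` is then null, and the shift by `-π` brings it to `a`. -/
lemma exists_null_arc (hμ : IsBMeasure K μ) (hK : IsSymmConvexBody K) {a : ℝ}
    (ha : a ∉ squareFixed (birkhoffAngle K) \ flatPoints (birkhoffAngle K)) :
    ∃ b, a < b ∧ μ (hK.bdryPoint '' Set.Icc a b) = 0 ∨
      b < a ∧ μ (hK.bdryPoint '' Set.Icc b a) = 0 := by
  have hpi := Real.pi_pos
  have hang := hμ.toIsAngularMeasure
  have cancel : ∀ {x : ℝ} {y : ENNReal}, ENNReal.ofReal x = ENNReal.ofReal x + y → y = 0 :=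
    fun {x y} h => by
      have : ENNReal.ofReal x + 0 = ENNReal.ofReal x + y := by rwa [add_zero]
      exact ((ENNReal.add_right_inj ENNReal.ofReal_ne_top).1 this).symm
  have htwo : ENNReal.ofReal (Real.pi / 2) + ENNReal.ofReal (Real.pi / 2) =
      ENNReal.ofReal Real.pi := by
    rw [← ENNReal.ofReal_add (by positivity) (by positivity), add_halves]
  by_cases hf : a ∈ flatPoints (birkhoffAngle K)
  · obtain ⟨g, g', b, h1, h2, hg, hg'⟩ := hf
    have h3 := hang.measure_image_Icc_add hK (h1.trans h2).le hg'.1.le (by linarith [hg.2.1])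
    rw [hμ.measure_quarter hK hg, hμ.measure_quarter hK hg', add_comm] at h3
    exact ⟨g', Or.inl ⟨h2, measure_mono_null
      (Set.image_mono (Set.Icc_subset_Icc_left h1.le)) (cancel h3)⟩⟩
  · obtain ⟨b, hab⟩ := hK.exists_birkhoffAngle_right a
    obtain ⟨c, hbc⟩ := hK.exists_birkhoffAngle_right b
    have hne : c ≠ a + Real.pi := by
      rintro rfl
      exact ha ⟨⟨b, hab, hbc⟩, hf⟩
    obtain ⟨l1, u1, -⟩ := id hab
    obtain ⟨l2, u2, -⟩ := id hbc
    have q1 := hμ.measure_quarter hK hab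
    have q2 := hμ.measure_quarter hK hbc
    have e1 := hang.measure_image_Icc_add hK l1.le l2.le (by linarith)
    rw [q1, q2, htwo] at e1
    refine ⟨c - Real.pi, ?_⟩
    rcases lt_or_gt_of_ne hne with hlt | hlt
    · right
      refine ⟨by linarith, ?_⟩
      have e2 := hang.measure_image_Icc_add hK (l1.trans l2).le hlt.le (by linarith)
      rw [hang.measure_half, e1] at e2
      have := cancel e2
      rwa [← hang.measure_image_Icc_add_pi hK, sub_add_cancel]
    · left
      refine ⟨by linarith, ?_⟩
      have e2 := hang.measure_image_Icc_add hK (show a ≤ a + Real.pi by linarith) hlt.le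
        (by linarith)
      rw [hang.measure_half, e1] at e2
      have := cancel e2
      rwa [← hang.measure_image_Icc_add_pi hK, sub_add_cancel]

lemma not_countable (hμ : IsBMeasure K μ) (hK : IsSymmConvexBody K) :
    ¬ (auerbachPoints K \ openSegmentUnion K).Countable := by
  intro hc
  have h1 := measure_image_endpoints_eq_zero μ hμ.continuous hK.bdryPoint
  have h2 : μ (Subtype.val ⁻¹' (auerbachPoints K \ openSegmentUnion K)) = 0 := by
    have hc' := hc.preimage (Subtype.val_injective (p := (· ∈ frontier K)))
    rw [← Set.biUnion_of_singleton (Subtype.val ⁻¹' _)]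
    exact (measure_biUnion_null_iff hc').2 fun x _ => hμ.continuous x
  have h3 : μ Set.univ = 0 := by
    refine measure_mono_null ?_ (measure_union_null h1 h2)
    intro x _
    obtain ⟨a, -, -, rfl⟩ := hK.exists_bdryPoint_eq x 0
    by_cases ha : a ∈ squareFixed (birkhoffAngle K) \ flatPoints (birkhoffAngle K)
    · right
      exact ⟨(hK.bdryPoint_mem_auerbachPoints_iff a).2 ha.1,
        fun h => ha.2 ((hK.bdryPoint_mem_openSegmentUnion_iff a).1 h)⟩
    · exact Or.inl ⟨a, hμ.exists_null_arc hK ha, rfl⟩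
  rw [hμ.total, ENNReal.ofReal_eq_zero] at h3
  linarith [Real.pi_pos]

end IsBMeasure

/-! ### From a semiconjugacy to a B-measure. -/

lemma add_int_mul_of_add {m : ℝ → ℝ} {c : ℝ} (hm : ∀ x, m (x + c) = m x + c) (n : ℤ) (x : ℝ) :
    m (x + n * c) = m x + n * c := by
  induction n using Int.induction_on generalizing x with
  | zero => simp
  | succ n ih =>
    have h := hm (x + n * c)
    have h' := ih x
    push_cast at h' ⊢
    rw [show x + (n + 1) * c = x + n * c + c by ring, h, h']
    ring
  | pred n ih =>
    have h := hm (x + (-n - 1) * c)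
    have h' := ih x
    push_cast at h' ⊢
    rw [show x + (-n - 1) * c + c = x + -n * c by ring, h'] at h
    linarith

/-- The Stieltjes measure of a function commuting with a translation is invariant under it. -/
lemma StieltjesFunction.measure_preimage_add_of_add (m : StieltjesFunction ℝ) {c : ℝ}
    (hm : ∀ x, m (x + c) = m x + c) {s : Set ℝ} (hs : MeasurableSet s) :
    m.measure ((fun x => x + c) ⁻¹' s) = m.measure s := by
  have hmeas : Measurable fun x : ℝ => x + c := measurable_add_const c
  have h : m.measure.map (fun x => x + c) = m.measure := by
    refine (Measure.ext_of_Ioc _ _ fun a b _ => ?_).symm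
    rw [Measure.map_apply hmeas measurableSet_Ioc, Set.preimage_add_const_Ioc,
      StieltjesFunction.measure_Ioc, StieltjesFunction.measure_Ioc]
    have h1 := hm (a - c)
    have h2 := hm (b - c)
    rw [sub_add_cancel] at h1 h2
    rw [h1, h2]
    congr 1
    ring
  rw [← Measure.map_apply hmeas hs, h]

namespace IsSymmConvexBody

variable {K : Set Plane}

/-- The measure on the boundary with angular distribution function `m`. -/
noncomputable def bdryMeasure (hK : IsSymmConvexBody K) (m : StieltjesFunction ℝ) :
    Measure (frontier K) :=
  (m.measure.restrict (Set.Ioc 0 (2 * Real.pi))).map hK.bdryPoint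

/-- All half-open windows of length `2π` are fundamental domains for a group preserving `m.measure`,
so the window may be chosen to suit the set. -/
lemma bdryMeasure_apply (hK : IsSymmConvexBody K) {m : StieltjesFunction ℝ}
    (hper : ∀ x, m (x + Real.pi) = m x + Real.pi) {X : Set (frontier K)} (hX : MeasurableSet X)
    (t : ℝ) : hK.bdryMeasure m X =
      m.measure (hK.bdryPoint ⁻¹' X ∩ Set.Ioc t (t + 2 * Real.pi)) := by
  have hmeas := hK.continuous_bdryPoint.measurable
  have hper2 : ∀ x, m (x + 2 * Real.pi) = m x + 2 * Real.pi := fun x => by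
    rw [two_mul, ← add_assoc, hper, hper]; ring
  have hsmul : ∀ (g : AddSubgroup.zmultiples (2 * Real.pi)), ∃ n : ℤ,
      (fun x : ℝ => g +ᵥ x) = fun x => x + n * (2 * Real.pi) := by
    rintro ⟨_, n, rfl⟩
    refine ⟨n, funext fun x => ?_⟩
    simp [AddSubgroup.vadd_def, add_comm]
  have : VAddInvariantMeasure (AddSubgroup.zmultiples (2 * Real.pi)) ℝ m.measure :=
    ⟨fun g s hs => by
      obtain ⟨n, hn⟩ := hsmul g
      rw [hn]
      exact m.measure_preimage_add_of_add (fun x => add_int_mul_of_add hper2 n x) hs⟩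
  rw [bdryMeasure, Measure.map_apply hmeas hX, Measure.restrict_apply (hmeas hX)]
  have hfd := (isAddFundamentalDomain_Ioc Real.two_pi_pos 0 m.measure).measure_set_eq
    (isAddFundamentalDomain_Ioc Real.two_pi_pos t m.measure) (hmeas hX) fun g => by
      obtain ⟨n, hn⟩ := hsmul g
      rw [hn]
      ext x
      have hp : Function.Periodic hK.bdryPoint (2 * Real.pi) := hK.bdryPoint_add_two_pi
      simp only [Set.mem_preimage]
      rw [hp.int_mul n x]
  rwa [zero_add] at hfd

lemma bdryMeasure_image_Icc (hK : IsSymmConvexBody K) {m : StieltjesFunction ℝ}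
    (hper : ∀ x, m (x + Real.pi) = m x + Real.pi) (hm : Continuous m) {a b : ℝ}
    (hb : b < a + 2 * Real.pi) :
    hK.bdryMeasure m (hK.bdryPoint '' Set.Icc a b) = ENNReal.ofReal (m b - m a) := by
  -- A window ending at `b` contains the whole closed interval, as `b < a + 2π`.
  rw [hK.bdryMeasure_apply hper (hK.measurableSet_image_Icc a b) (b - 2 * Real.pi)]
  have : hK.bdryPoint ⁻¹' (hK.bdryPoint '' Set.Icc a b) ∩
      Set.Ioc (b - 2 * Real.pi) (b - 2 * Real.pi + 2 * Real.pi) = Set.Icc a b := by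
    have hsub : Set.Icc a b ⊆ Set.Ioc (b - 2 * Real.pi) (b - 2 * Real.pi + 2 * Real.pi) :=
      fun x hx => ⟨by linarith [hx.1], by linarith [hx.2]⟩
    ext x
    constructor
    · rintro ⟨⟨s, hs, hsx⟩, hx⟩
      rwa [← hK.bdryPoint_injOn _ (hsub hs) hx hsx]
    · exact fun hx => ⟨⟨x, hx, rfl⟩, hsub hx⟩
  rw [this, StieltjesFunction.measure_Icc, hm.continuousWithinAt.leftLim_eq]

lemma isBMeasure_bdryMeasure (hK : IsSymmConvexBody K) {m : StieltjesFunction ℝ}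
    (hper : ∀ x, m (x + Real.pi) = m x + Real.pi) (hm : Continuous m)
    (hq : ∀ a b, birkhoffAngle K a b → m b = m a + Real.pi / 2) :
    IsBMeasure K (hK.bdryMeasure m) where
  total := by
    rw [hK.bdryMeasure_apply hper MeasurableSet.univ 0, Set.preimage_univ, Set.univ_inter,
      StieltjesFunction.measure_Ioc, two_mul, ← add_assoc, hper, hper]
    congr 1
    ring
  symm X hX := by
    have hpre : hK.bdryPoint ⁻¹' negSet K X =
        (fun x => x + Real.pi) ⁻¹' (hK.bdryPoint ⁻¹' X) := by
      ext a
      constructor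
      · rintro ⟨x, hx, h⟩
        have : hK.bdryPoint (a + Real.pi) = x := Subtype.ext (by
          rw [hK.coe_bdryPoint_add_pi, h, neg_neg])
        rwa [Set.mem_preimage, Set.mem_preimage, this]
      · exact fun h => ⟨_, h, by rw [hK.coe_bdryPoint_add_pi, neg_neg]⟩
    have hneg : ∀ x : frontier K, -(x : Plane) ∈ frontier K := fun x => by
      rw [← hK.gauge_eq_one_iff, gauge_neg hK.neg_mem, hK.gauge_eq_one_iff]
      exact x.2
    have hmeas : MeasurableSet (negSet K X) := by
      have hc : Continuous fun x : frontier K => (⟨-(x : Plane), hneg x⟩ : frontier K) :=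
        continuous_subtype_val.neg.subtype_mk _
      convert hc.measurable hX using 1
      ext z
      constructor
      · rintro ⟨x, hx, h⟩
        have : (⟨-(z : Plane), hneg z⟩ : frontier K) = x := Subtype.ext (by
          simp only [h, neg_neg])
        rwa [Set.mem_preimage, this]
      · exact fun h => ⟨_, h, (neg_neg _).symm⟩
    -- The windows starting at `0` and at `π` correspond under the shift by `π`.
    rw [hK.bdryMeasure_apply hper hmeas 0, hK.bdryMeasure_apply hper hX Real.pi, hpre,
      ← m.measure_preimage_add_of_add hper
        ((hK.continuous_bdryPoint.measurable hX).inter measurableSet_Ioc), Set.preimage_inter,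
      Set.preimage_add_const_Ioc]
    congr 3 <;> ring
  continuous x := by
    obtain ⟨a, -, -, rfl⟩ := hK.exists_bdryPoint_eq x 0
    have := hK.bdryMeasure_image_Icc hper hm (a := a) (b := a) (by linarith [Real.pi_pos])
    simpa using this
  arc C x y hC hno hxy := by
    have hpi := Real.pi_pos
    obtain ⟨a, -, -, rfl⟩ := hK.exists_bdryPoint_eq x 0
    obtain ⟨b, hb1, hb2, rfl⟩ := hK.exists_bdryPoint_eq y (a - Real.pi)
    rw [hK.birkhoffOrth_bdryPoint_iff] at hxy
    have hs := hK.sin_sub_ne_zero hxy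
    have hb3 : b < a + Real.pi := lt_of_le_of_ne (by linarith) (by rintro rfl; simp at hs)
    rw [hK.isClosedArc_eq hC hno ⟨hb1, hb3⟩]
    rcases lt_trichotomy a b with h | rfl | h
    · rw [Set.uIcc_of_le h.le, hK.bdryMeasure_image_Icc hper hm (by linarith),
        hq a b ⟨h, hb3, hxy⟩, add_sub_cancel_left]
    · simp at hs
    -- The arc runs backwards from `a` to `b`; passing to `-y` puts the pair into the relation, and
    -- the half-turn rule for `m` recovers the increment.
    · have hR : birkhoffAngle K a (b + Real.pi) :=
        ⟨by linarith, by linarith, by rwa [dirVec_add_pi, hK.birkhoffOrth_neg_right_iff]⟩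
      have h1 := hq _ _ hR
      rw [hper] at h1
      rw [Set.uIcc_of_ge h.le, hK.bdryMeasure_image_Icc hper hm (by linarith)]
      congr 1
      linarith

end IsSymmConvexBody

theorem theorem1 (K : Set Plane) (hK : IsSymmConvexBody K) :
    (∃ μ : Measure (frontier K), IsBMeasure K μ) ↔
      ¬ (auerbachPoints K \ openSegmentUnion K).Countable := by
  refine ⟨fun ⟨μ, hμ⟩ => hμ.not_countable hK, fun hc => ?_⟩
  obtain ⟨m, hcont, hmono, hper, hq⟩ := hK.isQuarterTurn.exists_semiconj
    hK.measurableSet_squareFixed fun h => hc <| by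
      refine (h.image fun a => (hK.bdryPoint a : Plane)).mono ?_
      intro x hx
      obtain ⟨a, ha1, ha2, ha⟩ := hK.exists_bdryPoint_eq ⟨x, hx.1.1⟩ 0
      have hax : (hK.bdryPoint a : Plane) = x := congrArg Subtype.val ha
      rw [← hax] at hx
      refine ⟨a, ⟨⟨(hK.bdryPoint_mem_auerbachPoints_iff a).1 hx.1,
        fun h => hx.2 ((hK.bdryPoint_mem_openSegmentUnion_iff a).2 h)⟩, ha1.le, ?_⟩, hax⟩
      linarith
  let S : StieltjesFunction ℝ := ⟨m, hmono, fun x => hcont.continuousWithinAt⟩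
  exact ⟨hK.bdryMeasure S, hK.isBMeasure_bdryMeasure hper hcont hq⟩
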